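/- Let $d_1,d_2\ge 0$, $d=d_1+d_2$, let $x=(x_1,x_2)\in\mathbb R^{d_1}\times\mathbb R^{d_2}=\mathbb R^d$, let $\Sigma=\begin{pmatrix}\Sigma_{11}&\Sigma_{12}\\ \Sigma_{21}&\Sigma_{22}\end{pmatrix}$ be a symmetric positive definite $d\times d$ matrix, and let $\mu=\mathcal N(x,\Sigma)$. Put $\Sigma_{1|2}=\Sigma_{11}-\Sigma_{12}\Sigma_{22}^{-1}\Sigma_{21}$ and, for $z_2\in\mathbb R^{d_2}$, $$\mu_1=\mu_1(\cdot\,|\,z_2)=\mathcal N\big(x_1+\Sigma_{12}\Sigma_{22}^{-1}(z_2-x_2),\ \Sigma_{1|2}\big),\qquad \mu_2=\mathcal N(x_2,\Sigma_{22}).$$ For a probability measure $\rho$ and a $\rho$-integrable function $g\ge 0$ let $\mathrm{Ent}_\rho(g)=\int g\log\frac{g}{\int g\,d\rho}\,d\rho\in(-\infty,\infty]$, with $0\log 0=0$ (and $\mathrm{Ent}_\rho(g)=0$ if $\int g\,d\rho=0$). Then $\mu_2$ is the marginal law of $z_2$ and $\mu_1(\cdot\,|\,z_2)$ is the conditional law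 of $z_1$ given $z_2$ when $(z_1,z_2)\sim\mu$, that is, $\mu(A)=\int\mu_1(\{z_1:(z_1,z_2)\in A\}\,|\,z_2)\,d\mu_2(z_2)$ for all Borel sets $A\subseteq\mathbb R^d$. Moreover, for every differentiable function $f_y:\mathbb R^d\to[0,\infty)$ the following hold, where quotients $0/0$ are read as $0$ and the right-hand sides may be $+\infty$. (i) If $f_y$ is $\mu$-integrable, then $$\mathrm{Ent}_\mu(f_y)\le\tfrac12\,\mathbb E_{z_2\sim\mu_2}\big[\mathcal I_{\mu_1}(f_y\,|\,z_2)\big],\qquad \mathcal I_{\mu_1}(f_y\,|\,z_2)=\int_{\mathbb R^{d_1}}\frac{\langle\Sigma\nabla f_y(z_1,z_2),\nabla f_y(z_1,z_2)\rangle}{f_y(z_1,z_2)}\,d\mu_1(z_1\,|\,z_2),$$ where $\nabla f_y$ is the gradient in all $d$ variables. (ii) For every fixed value $z_2\in\mathbb R^{d_2}$ of the second block (in particular for $z_2=x_2$) for which $f_y(\cdot,z_2)$ is $\mu_1(\cdot\,|\,z_2)$-integrable, $$\mathrm{Ent}_{\mu_1(\cdot|z_2)}\big(f_y(\cdot,z_2)\big)\le\tfrac12\int_{\mathbb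 R^{d_1}}\frac{\langle\Sigma_{1|2}\nabla_{z_1}f_y(z_1,z_2),\nabla_{z_1}f_y(z_1,z_2)\rangle}{f_y(z_1,z_2)}\,d\mu_1(z_1\,|\,z_2),$$ where $\nabla_{z_1}$ is the gradient in the first $d_1$ variables, and also $$\mathrm{Ent}_{\mu_1(\cdot|z_2)}\big(f_y(\cdot,z_2)\big)\le\tfrac12\,\mathcal I_{\mu_1}(f_y\,|\,z_2).$$ -/

import Mathlib

open MeasureTheory ProbabilityTheory Matrix
open scoped ENNReal

noncomputable section

namespace GaussianLogSobolev

/-- The vector `(z₁, z₂) ∈ ℝ^{d₁ + d₂}` with blocks `z₁ ∈ ℝ^{d₁}` and `z₂ ∈ ℝ^{d₂}`. -/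
def joinVec {d₁ d₂ : ℕ} (z₁ : EuclideanSpace ℝ (Fin d₁)) (z₂ : EuclideanSpace ℝ (Fin d₂)) :
    EuclideanSpace ℝ (Fin d₁ ⊕ Fin d₂) :=
  WithLp.toLp 2 (Sum.elim z₁ z₂)

/-- The functional entropy `∫ f log (f / ∫ f dμ) dμ ∈ (-∞, ∞]` of a non-negative `μ`-integrable
function `f`. The integral is written as the integral of the positive part minus that of the
negative part, so that the value is `⊤` where the integral diverges. (For `f ≥ 0` integrable
with respect to a probability measure, the negative part always has a finite integral.) -/
def functionalEntropy {E : Type*} [MeasurableSpace E] (μ : Measure E) (f : E → ℝ) : EReal :=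
  ((∫⁻ z, ENNReal.ofReal (f z * Real.log (f z / ∫ w, f w ∂μ)) ∂μ : ℝ≥0∞) : EReal) -
    ((∫⁻ z, ENNReal.ofReal (-(f z * Real.log (f z / ∫ w, f w ∂μ))) ∂μ : ℝ≥0∞) : EReal)

/-- The integrand `⟨S ∇f(z), ∇f(z)⟩ / f(z)` of the functional Fisher information. At a zero of a
non-negative differentiable `f` the gradient vanishes, and the value there is `0 / 0 = 0`. -/
def fisherDensity {ι : Type*} [Fintype ι] (S : Matrix ι ι ℝ) (f : EuclideanSpace ℝ ι → ℝ)
    (z : EuclideanSpace ℝ ι) : ℝ :=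
  ((S *ᵥ (gradient f z).ofLp) ⬝ᵥ (gradient f z).ofLp) / f z

/-- The functional Fisher information `∫ ⟨S ∇f, ∇f⟩ / f dμ ∈ [0, ∞]` with matrix `S`. -/
def fisherInfo {ι : Type*} [Fintype ι] (μ : Measure (EuclideanSpace ℝ ι)) (S : Matrix ι ι ℝ)
    (f : EuclideanSpace ℝ ι → ℝ) : ℝ≥0∞ :=
  ∫⁻ z, ENNReal.ofReal (fisherDensity S f z) ∂μ

variable {d₁ d₂ : ℕ}

/-- The covariance `Σ₁₁ - Σ₁₂ Σ₂₂⁻¹ Σ₂₁` of `z₁` given `z₂`. -/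
def condCov (S : Matrix (Fin d₁ ⊕ Fin d₂) (Fin d₁ ⊕ Fin d₂) ℝ) : Matrix (Fin d₁) (Fin d₁) ℝ :=
  S.toBlocks₁₁ - S.toBlocks₁₂ * S.toBlocks₂₂⁻¹ * S.toBlocks₂₁

/-- The mean `x₁ + Σ₁₂ Σ₂₂⁻¹ (z₂ - x₂)` of `z₁` given `z₂`. -/
def condMean (x₁ : EuclideanSpace ℝ (Fin d₁)) (x₂ : EuclideanSpace ℝ (Fin d₂))
    (S : Matrix (Fin d₁ ⊕ Fin d₂) (Fin d₁ ⊕ Fin d₂) ℝ) (z₂ : EuclideanSpace ℝ (Fin d₂)) :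
    EuclideanSpace ℝ (Fin d₁) :=
  x₁ + WithLp.toLp 2 ((S.toBlocks₁₂ * S.toBlocks₂₂⁻¹) *ᵥ (z₂ - x₂).ofLp)

/-- The Gaussian measure `μ = 𝓝((x₁, x₂), Σ)` on `ℝ^{d₁ + d₂}`. -/
def jointLaw (x₁ : EuclideanSpace ℝ (Fin d₁)) (x₂ : EuclideanSpace ℝ (Fin d₂))
    (S : Matrix (Fin d₁ ⊕ Fin d₂) (Fin d₁ ⊕ Fin d₂) ℝ) :
    Measure (EuclideanSpace ℝ (Fin d₁ ⊕ Fin d₂)) :=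
  multivariateGaussian (joinVec x₁ x₂) S

/-- The conditional law `μ₁` of `z₁` given the value `z₂`. -/
def condLaw (x₁ : EuclideanSpace ℝ (Fin d₁)) (x₂ : EuclideanSpace ℝ (Fin d₂))
    (S : Matrix (Fin d₁ ⊕ Fin d₂) (Fin d₁ ⊕ Fin d₂) ℝ) (z₂ : EuclideanSpace ℝ (Fin d₂)) :
    Measure (EuclideanSpace ℝ (Fin d₁)) :=
  multivariateGaussian (condMean x₁ x₂ S z₂) (condCov S)

/-- The marginal law `μ₂ = 𝓝(x₂, Σ₂₂)` of `z₂`. -/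
def marginalLaw (x₂ : EuclideanSpace ℝ (Fin d₂))
    (S : Matrix (Fin d₁ ⊕ Fin d₂) (Fin d₁ ⊕ Fin d₂) ℝ) : Measure (EuclideanSpace ℝ (Fin d₂)) :=
  multivariateGaussian x₂ S.toBlocks₂₂

/-- The Fisher information of `f` under the conditional law `μ₁` given `z₂`, with the gradient of
`f` in all variables and the full covariance:
`∫ ⟨Σ ∇f(z₁, z₂), ∇f(z₁, z₂)⟩ / f(z₁, z₂) dμ₁(z₁)`. -/
def condFisherInfo (x₁ : EuclideanSpace ℝ (Fin d₁)) (x₂ : EuclideanSpace ℝ (Fin d₂))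
    (S : Matrix (Fin d₁ ⊕ Fin d₂) (Fin d₁ ⊕ Fin d₂) ℝ)
    (f : EuclideanSpace ℝ (Fin d₁ ⊕ Fin d₂) → ℝ) (z₂ : EuclideanSpace ℝ (Fin d₂)) : ℝ≥0∞ :=
  ∫⁻ z₁, ENNReal.ofReal (fisherDensity S f (joinVec z₁ z₂)) ∂(condLaw x₁ x₂ S z₂)

end GaussianLogSobolev

end

namespace GaussianLogSobolev

open Filter Topology Set

/-! ### Monotone transport between densities on the line. -/

section Transport

variable {p q : ℝ → ℝ}

/-! Everything reduces to the logarithmic Sobolev inequality for a Gaussian, applied once to the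
joint law and once to the conditional law.

On the line (`integral_mul_log_le_of_integral_eq_one`) the proof is by mass transport. Let `φ` be
the Gaussian density, `∫ f φ = 1`, and let `T` push `f φ` to `φ`, so that `T' = f φ / φ(T)`. Then
`log f = log T' - T² / 2 + x² / 2`, and `log T' ≤ T' - 1` together with a completed square bounds `φ
(f log f - f'² / (2 f))` by the derivative of `φ f (T - x)`, whose integral contributes nothing
positive at infinity.

Subadditivity of entropy (`realEntropy_prod_le`) carries the inequality to product measures one
coordinate at a time. The functions so far lie between positive constants; a truncation that does
not increase Fisher information, with Fatou's lemma, removes this. The affine map `z ↦ x + √S z`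
turns `‖∇‖²` into `⟨S ∇, ∇⟩` and gives any Gaussian (`functionalEntropy_multivariateGaussian_le`).

For the blocks, `z₁ - Σ₁₂ Σ₂₂⁻¹ (z₂ - x₂)` is independent of `z₂` (`jointLaw_eq_map`, by
characteristic functions), so Fubini yields the disintegration, and with it (i). The second bound in
(ii) follows from the first because the Schur complement form is at most the full form
(`condCov_dotProduct_le`). -/

theorem hasStrictDerivAt_integral_Iic (hp : Continuous p) (hpi : Integrable p) (x : ℝ) :
    HasStrictDerivAt (fun x => ∫ t in Iic x, p t) (p x) x := by
  have h : (fun x => ∫ t in Iic x, p t) = fun x => (∫ t in Iic 0, p t) + ∫ t in (0 : ℝ)..x, p t := by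
    ext y
    rw [← intervalIntegral.integral_Iic_sub_Iic hpi.integrableOn hpi.integrableOn]
    ring
  rw [h]
  exact (hp.integral_hasStrictDerivAt 0 x).const_add _

theorem strictMono_integral_Iic (hp : Continuous p) (hpi : Integrable p) (h0 : ∀ x, 0 < p x) :
    StrictMono (fun x => ∫ t in Iic x, p t) :=
  strictMono_of_hasDerivAt_pos (fun x => (hasStrictDerivAt_integral_Iic hp hpi x).hasDerivAt) h0

theorem tendsto_integral_Iic_atTop (hpi : Integrable p) :
    Tendsto (fun x => ∫ t in Iic x, p t) atTop (𝓝 (∫ t, p t)) :=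
  (aecover_Iic tendsto_id).integral_tendsto_of_countably_generated hpi

theorem tendsto_integral_Iic_atBot (hpi : Integrable p) :
    Tendsto (fun x => ∫ t in Iic x, p t) atBot (𝓝 0) := by
  have h : Tendsto (fun x => ∫ t in Ioi x, p t) atBot (𝓝 (∫ t, p t)) :=
    (aecover_Ioi tendsto_id).integral_tendsto_of_countably_generated hpi
  have h2 := (tendsto_const_nhds (x := ∫ t, p t)).sub h
  rw [sub_self] at h2
  refine h2.congr fun x => ?_
  rw [← intervalIntegral.integral_Iic_add_Ioi (b := x) hpi.integrableOn hpi.integrableOn]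
  ring

/-- The range depends only on the total mass, so distribution functions of equal mass take the same
values; this makes the transport map finite everywhere. -/
theorem range_integral_Iic (hp : Continuous p) (hpi : Integrable p) (h0 : ∀ x, 0 < p x) :
    range (fun x => ∫ t in Iic x, p t) = Ioo 0 (∫ t, p t) := by
  have hm := strictMono_integral_Iic hp hpi h0
  have hc : Continuous (fun x => ∫ t in Iic x, p t) :=
    continuous_iff_continuousAt.2 fun x =>
      (hasStrictDerivAt_integral_Iic hp hpi x).hasDerivAt.continuousAt
  apply Subset.antisymm
  · rintro _ ⟨x, rfl⟩
    refine ⟨lt_of_le_of_lt ?_ (hm (sub_one_lt x)), lt_of_lt_of_le (hm (lt_add_one x)) ?_⟩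
    · exact hm.monotone.le_of_tendsto (tendsto_integral_Iic_atBot hpi) _
    · exact hm.monotone.ge_of_tendsto (tendsto_integral_Iic_atTop hpi) _
  · rintro u ⟨hu0, hu1⟩
    obtain ⟨a, ha⟩ := ((tendsto_integral_Iic_atBot hpi).eventually (gt_mem_nhds hu0)).exists
    obtain ⟨b, hb⟩ := ((tendsto_integral_Iic_atTop hpi).eventually (lt_mem_nhds hu1)).exists
    exact mem_range_of_exists_le_of_exists_ge hc ⟨a, ha.le⟩ ⟨b, hb.le⟩

/-- The monotone rearrangement between two continuous positive densities of equal mass. -/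
theorem exists_monotone_transport (hp : Continuous p) (hpi : Integrable p) (hp0 : ∀ x, 0 < p x)
    (hq : Continuous q) (hqi : Integrable q) (hq0 : ∀ x, 0 < q x)
    (hpq : ∫ x, p x = ∫ x, q x) :
    ∃ T : ℝ → ℝ, StrictMono T ∧ ∀ x, HasDerivAt T (p x / q (T x)) x := by
  have hex : ∀ x, ∃ y, ∫ t in Iic y, q t = ∫ t in Iic x, p t := fun x => by
    have : (∫ t in Iic x, p t) ∈ range (fun x => ∫ t in Iic x, q t) := by
      rw [range_integral_Iic hq hqi hq0, ← hpq, ← range_integral_Iic hp hpi hp0]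
      exact ⟨x, rfl⟩
    exact this
  choose T hT using hex
  have hP := strictMono_integral_Iic hp hpi hp0
  have hQ := strictMono_integral_Iic hq hqi hq0
  refine ⟨T, fun x y hxy => hQ.lt_iff_lt.1 ?_, fun x => ?_⟩
  · simpa only [hT] using hP hxy
  -- Near `x`, `T` is the local inverse of the distribution function of `q` composed with that of
  -- `p`; injectivity of the former identifies the two.
  · have hd := hasStrictDerivAt_integral_Iic hq hqi (T x)
    have hne := (hq0 (T x)).ne'
    have hdP := (hasStrictDerivAt_integral_Iic hp hpi x).hasDerivAt
    have hl := (hd.to_localInverse hne).hasDerivAt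
    simp only [hT x] at hl
    have hcomp := hl.comp x hdP
    rw [mul_comm, ← div_eq_mul_inv] at hcomp
    refine hcomp.congr_of_eventuallyEq ?_
    have hr := (hd.hasStrictFDerivAt_equiv hne).eventually_right_inverse
    simp only [hT x] at hr
    filter_upwards [hdP.continuousAt.eventually hr] with y hy
    exact hQ.injective ((hT y).trans hy.symm)

end Transport

/-! ### The logarithmic Sobolev inequality on the line. -/

section RealLine

theorem hasDerivAt_gaussianPDFReal (x : ℝ) :
    HasDerivAt (gaussianPDFReal 0 1) (-x * gaussianPDFReal 0 1 x) x := by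
  have h : gaussianPDFReal 0 1 = fun x => (√(2 * Real.pi))⁻¹ * Real.exp (-x ^ 2 / 2) := by
    ext y; simp [gaussianPDFReal]
  rw [h]
  have h1 : HasDerivAt (fun x : ℝ => -x ^ 2 / 2) (-x) x := by
    refine (((hasDerivAt_pow 2 x).neg).div_const 2).congr_deriv ?_
    norm_num
    ring
  refine (h1.exp.const_mul (√(2 * Real.pi))⁻¹).congr_deriv ?_
  ring

theorem continuous_gaussianPDFReal : Continuous (gaussianPDFReal 0 1) :=
  continuous_iff_continuousAt.2 fun x => (hasDerivAt_gaussianPDFReal x).continuousAt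

theorem log_gaussianPDFReal (x : ℝ) :
    Real.log (gaussianPDFReal 0 1 x) = Real.log (√(2 * Real.pi))⁻¹ - x ^ 2 / 2 := by
  simp only [gaussianPDFReal, NNReal.coe_one, mul_one, sub_zero]
  rw [Real.log_mul (by positivity) (Real.exp_pos _).ne', Real.log_exp]
  ring

theorem integrable_gaussianReal_iff {f : ℝ → ℝ} :
    Integrable f (gaussianReal 0 1) ↔ Integrable (fun x => gaussianPDFReal 0 1 x * f x) := by
  rw [gaussianReal_of_var_ne_zero 0 one_ne_zero,
    integrable_withDensity_iff_integrable_smul' (measurable_gaussianPDF 0 1)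
      (ae_of_all _ fun _ => gaussianPDF_lt_top)]
  simp [toReal_gaussianPDF]

/-- Change of variables `y = T x`. Only the image of `T` is integrated over, so surjectivity is not
needed. -/
theorem integrable_comp_mul_of_transport {p q T g : ℝ → ℝ}
    (hq0 : ∀ x, 0 < q x) (hT : StrictMono T) (hT' : ∀ x, HasDerivAt T (p x / q (T x)) x)
    (hg : Integrable fun y => q y * g y) (hpg : AEStronglyMeasurable fun x => p x * g (T x)) :
    Integrable fun x => p x * g (T x) := by
  refine ⟨hpg, ?_⟩
  have h := lintegral_image_eq_lintegral_abs_deriv_mul MeasurableSet.univ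
    (fun x _ => (hT' x).hasDerivWithinAt) hT.injective.injOn (fun y => ‖q y * g y‖ₑ)
  have h2 : ∀ x, ENNReal.ofReal |p x / q (T x)| * ‖q (T x) * g (T x)‖ₑ = ‖p x * g (T x)‖ₑ := by
    intro x
    rw [← Real.enorm_eq_ofReal_abs, ← enorm_mul]
    congr 1
    field_simp [(hq0 (T x)).ne']
  simp only [h2, Measure.restrict_univ] at h
  rw [HasFiniteIntegral, ← h]
  exact lt_of_le_of_lt (setLIntegral_le_lintegral _ _) hg.2

/-- The logarithmic Sobolev inequality on the line for a probability density bounded away from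
`0` and `∞`. -/
theorem integral_mul_log_le_of_integral_eq_one {f : ℝ → ℝ} {c C : ℝ} (hc : 0 < c)
    (hf : Differentiable ℝ f) (hcf : ∀ x, c ≤ f x) (hfC : ∀ x, f x ≤ C)
    (h1 : ∫ x, f x ∂(gaussianReal 0 1) = 1)
    (hI : Integrable (fun x => deriv f x ^ 2 / f x) (gaussianReal 0 1)) :
    ∫ x, f x * Real.log (f x) ∂(gaussianReal 0 1) ≤
      2⁻¹ * ∫ x, deriv f x ^ 2 / f x ∂(gaussianReal 0 1) := by
  set φ := gaussianPDFReal 0 1 with hφ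
  have hφc : Continuous φ := continuous_gaussianPDFReal
  have hφ0 : ∀ x, 0 < φ x := fun x => gaussianPDFReal_pos 0 1 x one_ne_zero
  have hf0 : ∀ x, 0 < f x := fun x => hc.trans_le (hcf x)
  have hfi : Integrable f (gaussianReal 0 1) :=
    Integrable.of_bound hf.continuous.aestronglyMeasurable C
      (ae_of_all _ fun x => by rw [Real.norm_of_nonneg (hf0 x).le]; exact hfC x)
  have hlogi : Integrable (fun x => f x * Real.log (f x)) (gaussianReal 0 1) := by
    refine hfi.mul_bdd (c := max |Real.log c| |Real.log C|) ?_ (ae_of_all _ fun x => ?_)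
    · exact (Real.measurable_log.comp hf.continuous.measurable).aestronglyMeasurable
    · exact abs_le_max_abs_abs (Real.log_le_log hc (hcf x)) (Real.log_le_log (hf0 x) (hfC x))
  have hpi : Integrable (fun x => φ x * f x) := integrable_gaussianReal_iff.1 hfi
  have hpc : Continuous (fun x => φ x * f x) := hφc.mul hf.continuous
  have hp0 : ∀ x, 0 < φ x * f x := fun x => mul_pos (hφ0 x) (hf0 x)
  obtain ⟨T, hTm, hT⟩ := exists_monotone_transport hpc hpi hp0 hφc
    (integrable_gaussianPDFReal 0 1) hφ0 (by
      rw [hφ, integral_gaussianPDFReal_eq_one 0 one_ne_zero, ← h1,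
        integral_gaussianReal_eq_integral_smul one_ne_zero]; rfl)
  have hTc : Continuous T := continuous_iff_continuousAt.2 fun x => (hT x).continuousAt
  have hw : Integrable (fun x => φ x * f x * |T x|) := by
    refine integrable_comp_mul_of_transport (g := fun y => |y|) hφ0 hTm hT ?_ ?_
    · refine integrable_gaussianReal_iff.1 ?_
      exact (IsGaussian.integrable_id (μ := gaussianReal 0 1)).abs
    · exact (hpc.mul hTc.abs).aestronglyMeasurable
  -- Displacement times transported density: its derivative dominates the entropy deficit.
  set H : ℝ → ℝ := fun x => φ x * f x * (T x - x) with hH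
  set H' : ℝ → ℝ := fun x => (-x * φ x * f x + φ x * deriv f x) * (T x - x) +
    φ x * f x * (φ x * f x / φ (T x) - 1) with hH'
  have hHd : ∀ x, HasDerivAt H (H' x) x := fun x =>
    ((hasDerivAt_gaussianPDFReal x).mul (hf x).hasDerivAt).mul ((hT x).sub (hasDerivAt_id x))
  have hfd : Integrable (fun x => φ x * deriv f x) := by
    refine integrable_gaussianReal_iff.1 ((hI.add hfi).mono'
      (measurable_deriv f).aestronglyMeasurable (ae_of_all _ fun x => ?_))
    have h := hf0 x
    simp only [Pi.add_apply, Real.norm_eq_abs]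
    -- Completing the square gives `|f'| ≤ f'² / f + f`, hence integrability of `f'`, which need not
    -- be continuous.
    have h3 : deriv f x ^ 2 / f x + f x - |deriv f x| =
        ((|deriv f x| - f x / 2) ^ 2 + 3 / 4 * f x ^ 2) / f x := by
      field_simp
      rw [← sq_abs (deriv f x)]
      ring
    have : 0 ≤ deriv f x ^ 2 / f x + f x - |deriv f x| := by rw [h3]; positivity
    linarith
  have hH'i : ∀ a b, IntervalIntegrable H' volume a b := by
    intro a b
    refine IntervalIntegrable.add ?_ ?_
    · refine IntervalIntegrable.mul_continuousOn ?_ (hTc.sub continuous_id).continuousOn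
      refine IntervalIntegrable.add ?_ hfd.intervalIntegrable
      exact ((continuous_neg.mul hφc).mul hf.continuous).intervalIntegrable a b
    · refine Continuous.intervalIntegrable ?_ a b
      exact hpc.mul ((hpc.div (hφc.comp hTc) fun x => (hφ0 _).ne').sub continuous_const)
  set D : ℝ → ℝ := fun x => φ x * (f x * Real.log (f x)) - 2⁻¹ * (φ x * (deriv f x ^ 2 / f x))
    with hD
  have hDi : Integrable D := (integrable_gaussianReal_iff.1 hlogi).sub
    ((integrable_gaussianReal_iff.1 hI).const_mul _)
  have hDle : ∀ x, D x ≤ H' x := by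
    intro x
    have hfx := hf0 x
    have hφx := hφ0 x
    have hφT := hφ0 (T x)
    -- The logarithm of the transport equation `φ f = φ(T) T'`.
    have hlog : Real.log (f x) = Real.log (φ x * f x / φ (T x)) - T x ^ 2 / 2 + x ^ 2 / 2 := by
      rw [Real.log_div (hp0 x).ne' hφT.ne', Real.log_mul hφx.ne' hfx.ne', hφ,
        log_gaussianPDFReal, log_gaussianPDFReal]
      ring
    have hle := Real.log_le_sub_one_of_pos (div_pos (hp0 x) hφT)
    have h3 : D x ≤ φ x * (f x * (φ x * f x / φ (T x) - 1 - T x ^ 2 / 2 + x ^ 2 / 2)) -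
        2⁻¹ * (φ x * (deriv f x ^ 2 / f x)) := by
      simp only [hD]
      gcongr
      rw [hlog]
      linarith
    have h4 : H' x - (φ x * (f x * (φ x * f x / φ (T x) - 1 - T x ^ 2 / 2 + x ^ 2 / 2)) -
        2⁻¹ * (φ x * (deriv f x ^ 2 / f x))) =
        2⁻¹ * φ x * ((f x * (T x - x) + deriv f x) ^ 2 / f x) := by
      simp only [hH']
      field_simp
      ring
    have h5 : 0 ≤ 2⁻¹ * φ x * ((f x * (T x - x) + deriv f x) ^ 2 / f x) := by positivity
    linarith
  have hbd : ∀ R, 0 ≤ R →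
      ∫ x in -R..R, D x ≤ φ R * f R * |T R| + φ (-R) * f (-R) * |T (-R)| := by
    intro R hR
    calc ∫ x in -R..R, D x ≤ ∫ x in -R..R, H' x :=
          intervalIntegral.integral_mono (by linarith) hDi.intervalIntegrable (hH'i _ _) hDle
      _ = H R - H (-R) := intervalIntegral.integral_eq_sub_of_hasDerivAt (fun x _ => hHd x)
          (hH'i _ _)
      _ ≤ _ := by
          simp only [hH]
          -- The terms in `R` have the favourable sign at both ends and are dropped, leaving only
          -- the integrable function `φ f |T|`.
          have e1 : φ R * f R * (T R - R) ≤ φ R * f R * |T R| :=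
            mul_le_mul_of_nonneg_left (by linarith [le_abs_self (T R)]) (hp0 R).le
          have e2 : φ (-R) * f (-R) * -(T (-R) - -R) ≤ φ (-R) * f (-R) * |T (-R)| :=
            mul_le_mul_of_nonneg_left (by linarith [neg_abs_le (T (-R))]) (hp0 (-R)).le
          linarith
  have hlim : Tendsto (fun R => ∫ x in -R..R, D x) atTop (𝓝 (∫ x, D x)) :=
    intervalIntegral_tendsto_integral hDi tendsto_neg_atTop_atBot tendsto_id
  -- A positive integral would eventually bound the integrable boundary terms below by a positive
  -- constant on a half-line.
  have hDneg : ∫ x, D x ≤ 0 := by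
    by_contra! hpos
    obtain ⟨R₀, hR₀⟩ := eventually_atTop.1
      ((hlim.eventually (lt_mem_nhds (half_lt_self hpos))).and (eventually_ge_atTop 0))
    have hwi : Integrable (fun x => φ x * f x * |T x| + φ (-x) * f (-x) * |T (-x)|) :=
      hw.add hw.comp_neg
    have hci : IntegrableOn (fun _ : ℝ => (∫ x, D x) / 2) (Ici R₀) := by
      refine Integrable.mono' hwi.integrableOn aestronglyMeasurable_const ?_
      filter_upwards [self_mem_ae_restrict measurableSet_Ici] with x hx
      rw [Real.norm_of_nonneg (half_pos hpos).le]
      exact (hR₀ x hx).1.le.trans (hbd x (hR₀ x hx).2)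
    rw [integrableOn_const_iff (by simp)] at hci
    rcases hci with h | h
    · linarith [enorm_eq_zero.1 h]
    · simp at h
  rw [integral_gaussianReal_eq_integral_smul one_ne_zero,
    integral_gaussianReal_eq_integral_smul one_ne_zero]
  rw [hD, integral_sub (integrable_gaussianReal_iff.1 hlogi)
    ((integrable_gaussianReal_iff.1 hI).const_mul _), integral_const_mul] at hDneg
  simp only [smul_eq_mul]
  linarith

end RealLine

/-! ### Entropy of functions between positive constants, and its subadditivity. -/

section Entropy

variable {X Y : Type*} [MeasurableSpace X] [MeasurableSpace Y]

/-- The entropy `∫ f log f dμ - (∫ f dμ) log (∫ f dμ)` as a real number. -/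
noncomputable def realEntropy (μ : Measure X) (f : X → ℝ) : ℝ :=
  ∫ x, f x * Real.log (f x) ∂μ - (∫ x, f x ∂μ) * Real.log (∫ x, f x ∂μ)

variable {μ : Measure X} {ν : Measure Y} {c C : ℝ}

theorem integrable_of_mem_Icc [IsFiniteMeasure μ] {f : X → ℝ} (hc : 0 < c) (hf : Measurable f)
    (hb : ∀ x, f x ∈ Icc c C) : Integrable f μ :=
  Integrable.of_bound hf.aestronglyMeasurable C (ae_of_all _ fun x => by
    rw [Real.norm_of_nonneg (hc.le.trans (hb x).1)]; exact (hb x).2)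

theorem integrable_mul_log_of_mem_Icc [IsFiniteMeasure μ] {f h : X → ℝ} {c' C' : ℝ}
    (hf : Integrable f μ) (hc' : 0 < c') (hh : Measurable h)
    (hb' : ∀ x, h x ∈ Icc c' C') : Integrable (fun x => f x * Real.log (h x)) μ := by
  refine hf.mul_bdd (c := max |Real.log c'| |Real.log C'|)
    (Real.measurable_log.comp hh).aestronglyMeasurable (ae_of_all _ fun x => ?_)
  exact abs_le_max_abs_abs (Real.log_le_log hc' (hb' x).1)
    (Real.log_le_log (hc'.trans_le (hb' x).1) (hb' x).2)

theorem integral_mem_Icc [IsProbabilityMeasure μ] {f : X → ℝ} (hc : 0 < c) (hf : Measurable f)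
    (hb : ∀ x, f x ∈ Icc c C) : ∫ x, f x ∂μ ∈ Icc c C := by
  have hi := integrable_of_mem_Icc (μ := μ) hc hf hb
  constructor
  · simpa using integral_mono (integrable_const c) hi fun x => (hb x).1
  · simpa using integral_mono hi (integrable_const C) fun x => (hb x).2

theorem sub_le_mul_log_sub {a b : ℝ} (ha : 0 < a) (hb : 0 < b) :
    a - b ≤ a * Real.log a - a * Real.log b := by
  have h := Real.log_le_sub_one_of_pos (div_pos hb ha)
  rw [Real.log_div hb.ne' ha.ne'] at h
  have h2 := mul_le_mul_of_nonneg_left h ha.le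
  have h3 : a * (b / a - 1) = b - a := by field_simp
  linarith [h2, h3, mul_sub a (Real.log b) (Real.log a)]

/-- The Gibbs variational inequality. -/
theorem integral_mul_log_le_realEntropy [IsProbabilityMeasure μ] {f h : X → ℝ} (hc : 0 < c)
    (hf : Measurable f) (hb : ∀ x, f x ∈ Icc c C) (hh : Measurable h)
    (hb' : ∀ x, h x ∈ Icc c C) :
    ∫ x, f x * Real.log (h x) ∂μ ≤ realEntropy μ f + (∫ x, f x ∂μ) * Real.log (∫ x, h x ∂μ) := by
  have hfi := integrable_of_mem_Icc (μ := μ) hc hf hb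
  have hhi := integrable_of_mem_Icc (μ := μ) hc hh hb'
  have hff := integrable_mul_log_of_mem_Icc hfi hc hf hb
  have hfh := integrable_mul_log_of_mem_Icc hfi hc hh hb'
  have hm := (integral_mem_Icc (μ := μ) hc hf hb).1
  have hM := (integral_mem_Icc (μ := μ) hc hh hb').1
  set m := ∫ x, f x ∂μ with hmdef
  set M := ∫ x, h x ∂μ with hMdef
  have hm0 : 0 < m := hc.trans_le hm
  have hM0 : 0 < M := hc.trans_le hM
  have key : ∀ x, f x * Real.log (h x) + f x - m / M * h x ≤
      f x * Real.log (f x) - f x * (Real.log m - Real.log M) := by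
    intro x
    have hfx : 0 < f x := hc.trans_le (hb x).1
    have hhx : 0 < h x := hc.trans_le (hb' x).1
    -- The function `h` is rescaled by `m / M` to have the mass of `f`, so the linear terms cancel
    -- on integration.
    have := sub_le_mul_log_sub hfx (mul_pos (div_pos hm0 hM0) hhx)
    rw [Real.log_mul (div_pos hm0 hM0).ne' hhx.ne', Real.log_div hm0.ne' hM0.ne'] at this
    linarith [mul_add (f x) (Real.log m - Real.log M) (Real.log (h x))]
  have hfhf : Integrable (fun x => f x * Real.log (h x) + f x) μ := hfh.add hfi
  have hint := integral_mono (hfhf.sub (hhi.const_mul (m / M)))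
    (hff.sub (hfi.mul_const (Real.log m - Real.log M))) key
  simp only [Pi.sub_apply] at hint
  rw [integral_sub hfhf (hhi.const_mul _), integral_add hfh hfi,
    integral_sub hff (hfi.mul_const _), integral_const_mul, integral_mul_const, ← hmdef, ← hMdef,
    div_mul_cancel₀ _ hM0.ne'] at hint
  rw [realEntropy, ← hmdef]
  linarith [mul_sub m (Real.log m) (Real.log M)]

/-- Subadditivity of the entropy on product spaces. -/
theorem realEntropy_prod_le [IsProbabilityMeasure μ] [IsProbabilityMeasure ν] {f : X × Y → ℝ}
    (hc : 0 < c) (hf : Measurable f) (hb : ∀ z, f z ∈ Icc c C) :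
    realEntropy (μ.prod ν) f ≤
      ∫ y, realEntropy μ (fun x => f (x, y)) ∂ν + ∫ x, realEntropy ν (fun y => f (x, y)) ∂μ := by
  have hfi := integrable_of_mem_Icc (μ := μ.prod ν) hc hf hb
  have hff := integrable_mul_log_of_mem_Icc hfi hc hf hb
  have hfx : ∀ x, Measurable fun y => f (x, y) := fun x => hf.comp measurable_prodMk_left
  have hfy : ∀ y, Measurable fun x => f (x, y) := fun y => hf.comp measurable_prodMk_right
  set F : Y → ℝ := fun y => ∫ x, f (x, y) ∂μ with hF
  set G : X → ℝ := fun x => ∫ y, f (x, y) ∂ν with hG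
  have hFm : Measurable F := hf.stronglyMeasurable.integral_prod_left'.measurable
  have hGm : Measurable G := hf.stronglyMeasurable.integral_prod_right'.measurable
  have hFb : ∀ y, F y ∈ Icc c C := fun y => integral_mem_Icc hc (hfy y) fun x => hb _
  have hGb : ∀ x, G x ∈ Icc c C := fun x => integral_mem_Icc hc (hfx x) fun y => hb _
  have hFi := integrable_of_mem_Icc (μ := ν) hc hFm hFb
  have hGi := integrable_of_mem_Icc (μ := μ) hc hGm hGb
  have hFF := integrable_mul_log_of_mem_Icc hFi hc hFm hFb
  have hGG := integrable_mul_log_of_mem_Icc hGi hc hGm hGb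
  have hfF : Integrable (fun z : X × Y => f z * Real.log (F z.2)) (μ.prod ν) :=
    integrable_mul_log_of_mem_Icc hfi hc (hFm.comp measurable_snd) fun z => hFb z.2
  have hm1 : ∫ z, f z ∂(μ.prod ν) = ∫ y, F y ∂ν := integral_prod_symm _ hfi
  have hm2 : ∫ z, f z ∂(μ.prod ν) = ∫ x, G x ∂μ := integral_prod _ hfi
  have e1 : ∫ y, realEntropy μ (fun x => f (x, y)) ∂ν =
      ∫ z, f z * Real.log (f z) ∂(μ.prod ν) - ∫ y, F y * Real.log (F y) ∂ν := by
    rw [integral_prod_symm _ hff, ← integral_sub hff.integral_prod_right hFF]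
    rfl
  have e2i : Integrable (fun x => realEntropy ν (fun y => f (x, y))) μ :=
    hff.integral_prod_left.sub hGG
  have e3 : ∫ y, F y * Real.log (F y) ∂ν = ∫ x, ∫ y, f (x, y) * Real.log (F y) ∂ν ∂μ := by
    rw [← integral_prod _ hfF, integral_prod_symm _ hfF]
    simp only [integral_mul_const, hF]
  -- The variational inequality on each slice `f (x, ·)`, tested against the marginal `F`.
  have e4 : ∫ x, ∫ y, f (x, y) * Real.log (F y) ∂ν ∂μ ≤
      ∫ x, (realEntropy ν (fun y => f (x, y)) + G x * Real.log (∫ y, F y ∂ν)) ∂μ :=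
    integral_mono hfF.integral_prod_left (e2i.add (hGi.mul_const _)) fun x =>
      integral_mul_log_le_realEntropy hc (hfx x) (fun y => hb _) hFm hFb
  rw [integral_add e2i (hGi.mul_const _), integral_mul_const, ← hm2, ← hm1] at e4
  rw [e1, realEntropy]
  linarith

/-- If `f` is not integrable, its integral is `0` by convention. Sliced inequalities can thus be
integrated without checking integrability of the sliced entropies. -/
theorem ofReal_integral_le_lintegral_ofReal (f : X → ℝ) :
    ENNReal.ofReal (∫ x, f x ∂μ) ≤ ∫⁻ x, ENNReal.ofReal (f x) ∂μ := by
  by_cases hf : Integrable f μ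
  · rw [integral_eq_lintegral_pos_part_sub_lintegral_neg_part hf]
    exact (ENNReal.ofReal_le_ofReal (sub_le_self _ ENNReal.toReal_nonneg)).trans
      ENNReal.ofReal_toReal_le
  · simp [integral_undef hf]

theorem realEntropy_map {T : X → Y} (hT : Measurable T) {f : Y → ℝ} (hf : Measurable f) :
    realEntropy (μ.map T) f = realEntropy μ (fun x => f (T x)) := by
  rw [realEntropy, realEntropy, integral_map hT.aemeasurable hf.aestronglyMeasurable,
    integral_map (f := fun y => f y * Real.log (f y)) hT.aemeasurable
      (hf.mul (Real.measurable_log.comp hf)).aestronglyMeasurable]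

theorem realEntropy_eq_zero_of_subsingleton [Subsingleton X] [IsProbabilityMeasure μ]
    (f : X → ℝ) : realEntropy μ f = 0 := by
  obtain ⟨a, ha⟩ : ∃ a, f = fun _ => a := by
    rcases isEmpty_or_nonempty X with h | ⟨⟨x⟩⟩
    · exact ⟨0, Subsingleton.elim _ _⟩
    · exact ⟨f x, funext fun y => by rw [Subsingleton.elim y x]⟩
  simp [realEntropy, ha]

end Entropy

/-! ### Tensorization to the standard Gaussian measure. -/

section StdGaussian

variable {c C : ℝ}

/-- Both sides are homogeneous of degree one in `f`, so dividing by the mean reduces to mass one.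
Infinite Fisher information is trivial. -/
theorem ofReal_realEntropy_gaussianReal_le {f : ℝ → ℝ} (hc : 0 < c) (hf : Differentiable ℝ f)
    (hb : ∀ x, f x ∈ Icc c C) :
    ENNReal.ofReal (realEntropy (gaussianReal 0 1) f) ≤
      2⁻¹ * ∫⁻ x, ENNReal.ofReal (deriv f x ^ 2 / f x) ∂(gaussianReal 0 1) := by
  rcases eq_or_ne (∫⁻ x, ENNReal.ofReal (deriv f x ^ 2 / f x) ∂(gaussianReal 0 1)) ⊤ with h | h
  · rw [h, ENNReal.mul_top (by simp)]; exact le_top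
  have hf0 : ∀ x, 0 < f x := fun x => hc.trans_le (hb x).1
  have hnn : ∀ x, 0 ≤ deriv f x ^ 2 / f x := fun x => div_nonneg (sq_nonneg _) (hf0 x).le
  have hI : Integrable (fun x => deriv f x ^ 2 / f x) (gaussianReal 0 1) :=
    (lintegral_ofReal_ne_top_iff_integrable
      (((measurable_deriv f).pow_const 2).div hf.continuous.measurable).aestronglyMeasurable
      (ae_of_all _ hnn)).1 h
  have hfi := integrable_of_mem_Icc (μ := gaussianReal 0 1) hc hf.continuous.measurable hb
  have hff := integrable_mul_log_of_mem_Icc hfi hc hf.continuous.measurable hb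
  set m := ∫ x, f x ∂(gaussianReal 0 1) with hm
  have hm0 : 0 < m := hc.trans_le (integral_mem_Icc hc hf.continuous.measurable hb).1
  have hd : ∀ x, deriv (fun x => m⁻¹ * f x) x ^ 2 / (m⁻¹ * f x) =
      m⁻¹ * (deriv f x ^ 2 / f x) := by
    intro x
    have := (hf0 x).ne'
    rw [deriv_const_mul _ (hf x)]
    field_simp
  have key := integral_mul_log_le_of_integral_eq_one (f := fun x => m⁻¹ * f x) (c := m⁻¹ * c)
    (C := m⁻¹ * C) (by positivity) (hf.const_mul _) (fun x => by have := (hb x).1; gcongr)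
    (fun x => by have := (hb x).2; gcongr)
    (by rw [integral_const_mul, ← hm, inv_mul_cancel₀ hm0.ne'])
    (by simp only [hd]; exact hI.const_mul _)
  simp only [hd] at key
  have hl : ∀ x, m⁻¹ * f x * Real.log (m⁻¹ * f x) =
      m⁻¹ * (f x * Real.log (f x) - f x * Real.log m) := by
    intro x
    rw [Real.log_mul (by positivity) (hf0 x).ne', Real.log_inv]
    ring
  simp only [hl] at key
  rw [integral_const_mul, integral_const_mul, integral_sub hff (hfi.mul_const _),
    integral_mul_const, ← hm, mul_left_comm] at key
  have key2 := le_of_mul_le_mul_left key (by positivity)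
  rw [← ofReal_integral_eq_lintegral_ofReal hI (ae_of_all _ hnn)]
  calc _ ≤ ENNReal.ofReal (2⁻¹ * ∫ x, deriv f x ^ 2 / f x ∂(gaussianReal 0 1)) :=
        ENNReal.ofReal_le_ofReal key2
    _ = _ := by
        rw [ENNReal.ofReal_mul (by norm_num), ENNReal.ofReal_inv_of_pos (by norm_num)]
        simp

/-- The standard Gaussian measure on `ℝⁿ` as a product measure. -/
noncomputable abbrev piGaussian (n : ℕ) : Measure (Fin n → ℝ) :=
  Measure.pi fun _ => gaussianReal 0 1

theorem measurePreserving_cons_piGaussian (n : ℕ) :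
    MeasurePreserving (fun p : ℝ × (Fin n → ℝ) => (Fin.cons p.1 p.2 : Fin (n + 1) → ℝ))
      ((gaussianReal 0 1).prod (piGaussian n)) (piGaussian (n + 1)) := by
  have h := (measurePreserving_piFinSuccAbove (fun _ : Fin (n + 1) => gaussianReal 0 1) 0).symm
  convert h using 1
  ext p i
  refine Fin.cases ?_ (fun i => ?_) i <;> simp [MeasurableEquiv.piFinSuccAbove]

theorem hasDerivAt_comp_cons_left {n : ℕ} {f : (Fin (n + 1) → ℝ) → ℝ} (hf : Differentiable ℝ f)
    (x : ℝ) (y : Fin n → ℝ) :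
    HasDerivAt (fun x => f (Fin.cons x y))
      (fderiv ℝ f (Fin.cons x y) (Pi.single 0 1)) x := by
  refine (hf (Fin.cons x y)).hasFDerivAt.comp_hasDerivAt x ?_
  rw [hasDerivAt_pi]
  refine Fin.cases ?_ fun i => ?_
  · simpa using hasDerivAt_id' x
  · simpa using hasDerivAt_const x (y i)

theorem hasFDerivAt_comp_cons_right {n : ℕ} {f : (Fin (n + 1) → ℝ) → ℝ}
    (hf : Differentiable ℝ f) (x : ℝ) (y : Fin n → ℝ) :
    HasFDerivAt (fun y => f (Fin.cons x y))
      ((fderiv ℝ f (Fin.cons x y)).comp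
        (ContinuousLinearMap.finCons 0 (ContinuousLinearMap.id ℝ (Fin n → ℝ)))) y := by
  refine (hf (Fin.cons x y)).hasFDerivAt.comp y ?_
  exact HasFDerivAt.finCons (hasFDerivAt_const x y) (hasFDerivAt_id y)

/-- Induction on `n`: subadditivity splits off the first coordinate, and the squared partial
derivatives add up. -/
theorem ofReal_realEntropy_piGaussian_le (n : ℕ) {f : (Fin n → ℝ) → ℝ} (hc : 0 < c)
    (hf : Differentiable ℝ f) (hb : ∀ x, f x ∈ Icc c C) :
    ENNReal.ofReal (realEntropy (piGaussian n) f) ≤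
      2⁻¹ * ∫⁻ x, ENNReal.ofReal ((∑ i, fderiv ℝ f x (Pi.single i 1) ^ 2) / f x)
        ∂(piGaussian n) := by
  induction n with
  | zero => simp [realEntropy_eq_zero_of_subsingleton]
  | succ n ih =>
    have hmp := measurePreserving_cons_piGaussian n
    have hf0 : ∀ x, 0 < f x := fun x => hc.trans_le (hb x).1
    have hfm := hf.continuous.measurable
    set A : (Fin (n + 1) → ℝ) → ℝ≥0∞ :=
      fun z => ENNReal.ofReal (fderiv ℝ f z (Pi.single 0 1) ^ 2 / f z) with hA
    set B : (Fin (n + 1) → ℝ) → ℝ≥0∞ :=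
      fun z => ENNReal.ofReal ((∑ i : Fin n, fderiv ℝ f z (Pi.single i.succ 1) ^ 2) / f z) with hB
    have hAm : Measurable A :=
      (((measurable_fderiv_apply_const ℝ f _).pow_const 2).div hfm).ennreal_ofReal
    have hBm : Measurable B := ((Finset.measurable_sum _ fun i _ =>
      (measurable_fderiv_apply_const ℝ f _).pow_const 2).div hfm).ennreal_ofReal
    have hAB : ∀ z, ENNReal.ofReal ((∑ i, fderiv ℝ f z (Pi.single i 1) ^ 2) / f z) =
        A z + B z := by
      intro z
      have := hf0 z
      rw [hA, hB, ← ENNReal.ofReal_add (by positivity) (by positivity), Fin.sum_univ_succ, add_div]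
    have h1 : ∀ y, ENNReal.ofReal (realEntropy (gaussianReal 0 1) fun x => f (Fin.cons x y)) ≤
        2⁻¹ * ∫⁻ x, A (Fin.cons x y) ∂(gaussianReal 0 1) := by
      intro y
      have h := ofReal_realEntropy_gaussianReal_le (f := fun x => f (Fin.cons x y)) hc
        (fun x => (hasDerivAt_comp_cons_left hf x y).differentiableAt) fun x => hb _
      simpa only [(hasDerivAt_comp_cons_left hf _ y).deriv] using h
    have h2 : ∀ x, ENNReal.ofReal (realEntropy (piGaussian n) fun y => f (Fin.cons x y)) ≤
        2⁻¹ * ∫⁻ y, B (Fin.cons x y) ∂(piGaussian n) := by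
      intro x
      have h := ih (f := fun y => f (Fin.cons x y))
        (fun y => (hasFDerivAt_comp_cons_right hf x y).differentiableAt) fun x => hb _
      have hs : ∀ i : Fin n, (ContinuousLinearMap.finCons 0 (ContinuousLinearMap.id ℝ (Fin n → ℝ)) :
          (Fin n → ℝ) →L[ℝ] (Fin (n + 1) → ℝ)) (Pi.single i 1) = Pi.single i.succ 1 := by
        intro i
        ext j
        refine Fin.cases ?_ (fun j => ?_) j
        · simp
        · simp [Pi.single_apply]
      simpa only [(hasFDerivAt_comp_cons_right hf x _).fderiv, ContinuousLinearMap.comp_apply, hs]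
        using h
    have hent : realEntropy (piGaussian (n + 1)) f = realEntropy
        ((gaussianReal 0 1).prod (piGaussian n)) fun p => f (Fin.cons p.1 p.2) := by
      rw [← hmp.map_eq, realEntropy_map hmp.measurable hfm]
    have hAi : ∫⁻ y, ∫⁻ x, A (Fin.cons x y) ∂(gaussianReal 0 1) ∂(piGaussian n) =
        ∫⁻ z, A z ∂(piGaussian (n + 1)) := by
      rw [← hmp.lintegral_comp hAm]
      exact (lintegral_prod_symm _ (hAm.comp hmp.measurable).aemeasurable).symm
    have hBi : ∫⁻ x, ∫⁻ y, B (Fin.cons x y) ∂(piGaussian n) ∂(gaussianReal 0 1) =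
        ∫⁻ z, B z ∂(piGaussian (n + 1)) := by
      rw [← hmp.lintegral_comp hBm]
      exact (lintegral_prod _ (hBm.comp hmp.measurable).aemeasurable).symm
    simp only [hAB]
    rw [lintegral_add_left hAm, mul_add, ← hAi, ← hBi, hent, ← lintegral_const_mul' _ _ (by simp),
      ← lintegral_const_mul' _ _ (by simp)]
    refine (ENNReal.ofReal_le_ofReal (realEntropy_prod_le hc (hfm.comp hmp.measurable)
      fun _ => hb _)).trans (ENNReal.ofReal_add_le.trans (add_le_add ?_ ?_))
    · exact (ofReal_integral_le_lintegral_ofReal _).trans (lintegral_mono h1)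
    · exact (ofReal_integral_le_lintegral_ofReal _).trans (lintegral_mono h2)

/-- The logarithmic Sobolev inequality for the standard Gaussian measure and functions bounded
away from `0` and `∞`. -/
theorem ofReal_realEntropy_stdGaussian_le {E : Type*} [NormedAddCommGroup E]
    [InnerProductSpace ℝ E] [FiniteDimensional ℝ E] [MeasurableSpace E] [BorelSpace E]
    {f : E → ℝ} (hc : 0 < c) (hf : Differentiable ℝ f) (hb : ∀ x, f x ∈ Icc c C) :
    ENNReal.ofReal (realEntropy (stdGaussian E) f) ≤
      2⁻¹ * ∫⁻ x, ENNReal.ofReal (‖gradient f x‖ ^ 2 / f x) ∂(stdGaussian E) := by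
  set b := stdOrthonormalBasis ℝ E
  set L : (Fin (Module.finrank ℝ E) → ℝ) →L[ℝ] E :=
    ∑ i, (ContinuousLinearMap.proj i).smulRight (b i) with hL
  have hLa : ∀ x, L x = ∑ i, x i • b i := fun x => by simp [hL]
  have hstd : stdGaussian E = (piGaussian _).map L := by
    rw [stdGaussian]; congr 1; ext x; exact (hLa x).symm
  have hLs : ∀ i, L (Pi.single i 1) = b i := fun i => by
    rw [hLa, Finset.sum_eq_single i] <;> simp +contextual
  have hd : ∀ x, HasFDerivAt (fun x => f (L x)) ((fderiv ℝ f (L x)).comp L) x := fun x =>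
    (hf (L x)).hasFDerivAt.comp x L.hasFDerivAt
  have h := ofReal_realEntropy_piGaussian_le _ (f := fun x => f (L x)) hc
    (fun x => (hd x).differentiableAt) fun x => hb _
  have hsq : ∀ x, ∑ i, fderiv ℝ f x (b i) ^ 2 = ‖gradient f x‖ ^ 2 := by
    intro x
    rw [← b.sum_sq_inner_left]
    simp [gradient]
  simp only [(hd _).fderiv, ContinuousLinearMap.comp_apply, hLs, hsq] at h
  have hm : Measurable fun x => ENNReal.ofReal (‖gradient f x‖ ^ 2 / f x) := by
    simp only [← hsq]
    exact ((Finset.measurable_sum _ fun i _ =>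
      (measurable_fderiv_apply_const ℝ f _).pow_const 2).div hf.continuous.measurable).ennreal_ofReal
  rwa [hstd, lintegral_map hm L.continuous.measurable,
    realEntropy_map L.continuous.measurable hf.continuous.measurable]

end StdGaussian

/-! ### Smooth truncation and its effect on Fisher information. -/

section Truncation

/-- A smooth truncation of `f ≥ 0` with values in `[ε, ε + ε⁻¹]`, converging to `f` as `ε → 0`. -/
noncomputable def truncation {X : Type*} (ε : ℝ) (f : X → ℝ) (x : X) : ℝ :=
  ε + f x / (1 + ε * f x)

theorem truncation_mem_Icc {X : Type*} {ε : ℝ} (hε : 0 < ε) {f : X → ℝ} {x : X} (hf : 0 ≤ f x) :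
    truncation ε f x ∈ Icc ε (ε + ε⁻¹) := by
  have h : 0 < 1 + ε * f x := by positivity
  refine ⟨le_add_of_nonneg_right (div_nonneg hf h.le), ?_⟩
  rw [truncation, add_le_add_iff_left, div_le_iff₀ h]
  field_simp
  linarith

theorem truncation_le {X : Type*} {ε : ℝ} (hε : 0 < ε) {f : X → ℝ} {x : X} (hf : 0 ≤ f x) :
    truncation ε f x ≤ ε + f x := by
  rw [truncation, add_le_add_iff_left]
  exact div_le_self hf (by nlinarith)

theorem tendsto_truncation {X : Type*} (f : X → ℝ) (x : X) :
    Tendsto (fun ε => truncation ε f x) (𝓝 0) (𝓝 (f x)) := by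
  have : ContinuousAt (fun ε => truncation ε f x) 0 := by
    unfold truncation
    refine continuousAt_id.add (continuousAt_const.div ?_ (by simp))
    exact continuousAt_const.add (continuousAt_id.mul continuousAt_const)
  simpa [ContinuousAt, truncation] using this

theorem norm_gradient {E : Type*} [NormedAddCommGroup E] [InnerProductSpace ℝ E] [CompleteSpace E]
    (f : E → ℝ) (x : E) : ‖gradient f x‖ = ‖fderiv ℝ f x‖ := by
  rw [gradient, LinearIsometryEquiv.norm_map]

theorem hasFDerivAt_truncation {E : Type*} [NormedAddCommGroup E] [NormedSpace ℝ E] {ε : ℝ}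
    (hε : 0 < ε) {f : E → ℝ} {x : E} (hf0 : 0 ≤ f x) (hf : DifferentiableAt ℝ f x) :
    HasFDerivAt (truncation ε f) (((1 + ε * f x) ^ 2)⁻¹ • fderiv ℝ f x) x := by
  have h : 0 < 1 + ε * f x := by positivity
  have hd : HasDerivAt (fun u => ε + u / (1 + ε * u)) ((1 + ε * f x) ^ 2)⁻¹ (f x) := by
    have h1 : HasDerivAt (fun u => 1 + ε * u) ε (f x) := by
      simpa using ((hasDerivAt_id' (f x)).const_mul ε).const_add 1
    refine (((hasDerivAt_id' (f x)).div h1 h.ne').const_add ε).congr_deriv ?_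
    field_simp
    ring
  exact hd.comp_hasFDerivAt x hf.hasFDerivAt

/-- The chain rule gives a factor `(1 + ε f)⁻⁴` on the squared gradient and the denominator loses at
most `(1 + ε f)⁻¹`, leaving `(1 + ε f)⁻³ ≤ 1`. Zeros of `f` are minima, where the gradient vanishes.
-/
theorem norm_gradient_truncation_le {E : Type*} [NormedAddCommGroup E] [InnerProductSpace ℝ E]
    [CompleteSpace E] {ε : ℝ} (hε : 0 < ε) {f : E → ℝ} (hf0 : ∀ x, 0 ≤ f x)
    (hf : Differentiable ℝ f) (x : E) :
    ‖gradient (truncation ε f) x‖ ^ 2 / truncation ε f x ≤ ‖gradient f x‖ ^ 2 / f x := by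
  rw [norm_gradient, norm_gradient, (hasFDerivAt_truncation hε (hf0 x) (hf x)).fderiv, norm_smul]
  rcases (hf0 x).eq_or_lt with h | h
  · have : fderiv ℝ f x = 0 :=
      IsLocalMin.fderiv_eq_zero (Eventually.of_forall fun y => h ▸ hf0 y)
    simp [this]
  · have h1 : 1 ≤ 1 + ε * f x := by nlinarith
    have h2 : f x / (1 + ε * f x) ≤ truncation ε f x := by
      rw [truncation]; linarith
    rw [Real.norm_of_nonneg (by positivity)]
    calc (((1 + ε * f x) ^ 2)⁻¹ * ‖fderiv ℝ f x‖) ^ 2 / truncation ε f x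
        ≤ (((1 + ε * f x) ^ 2)⁻¹ * ‖fderiv ℝ f x‖) ^ 2 / (f x / (1 + ε * f x)) := by gcongr
      _ = (‖fderiv ℝ f x‖ ^ 2 / f x) / (1 + ε * f x) ^ 3 := by
          field_simp
      _ ≤ ‖fderiv ℝ f x‖ ^ 2 / f x := div_le_self (by positivity) (one_le_pow₀ h1)

end Truncation

/-! ### Removal of the bounds on the function. -/

section LogSobolev

variable {E : Type*} [NormedAddCommGroup E] [InnerProductSpace ℝ E] [FiniteDimensional ℝ E]
  [MeasurableSpace E] [BorelSpace E]

/-- The correction `f - ∫ f` has integral zero and makes the integrand nonnegative, a form of the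
entropy suited to Fatou's lemma. -/
theorem lintegral_ofReal_sub_eq_realEntropy {X : Type*} [MeasurableSpace X] {μ : Measure X}
    [IsProbabilityMeasure μ] {f : X → ℝ} {c C : ℝ} (hc : 0 < c) (hf : Measurable f)
    (hb : ∀ x, f x ∈ Icc c C) :
    ∫⁻ x, ENNReal.ofReal (f x * Real.log (f x) - f x * Real.log (∫ x, f x ∂μ) -
      (f x - ∫ x, f x ∂μ)) ∂μ = ENNReal.ofReal (realEntropy μ f) := by
  have hfi := integrable_of_mem_Icc (μ := μ) hc hf hb
  have hff := integrable_mul_log_of_mem_Icc hfi hc hf hb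
  have hm := (integral_mem_Icc (μ := μ) hc hf hb).1
  have h1 : Integrable (fun x => f x * Real.log (f x) - f x * Real.log (∫ x, f x ∂μ)) μ :=
    hff.sub (hfi.mul_const _)
  have h2 : Integrable (fun x => f x - ∫ x, f x ∂μ) μ := hfi.sub (integrable_const _)
  have h12 : Integrable (fun x => f x * Real.log (f x) - f x * Real.log (∫ x, f x ∂μ) -
      (f x - ∫ x, f x ∂μ)) μ := h1.sub h2
  rw [← ofReal_integral_eq_lintegral_ofReal h12
    (ae_of_all _ fun x => sub_nonneg.2 (sub_le_mul_log_sub (hc.trans_le (hb x).1)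
      (hc.trans_le hm))), integral_sub h1 h2, integral_sub hff (hfi.mul_const _),
    integral_sub hfi (integrable_const _), integral_mul_const, realEntropy]
  simp

theorem lintegral_ofReal_entropy_stdGaussian_le {f : E → ℝ} (hf0 : ∀ x, 0 ≤ f x)
    (hf : Differentiable ℝ f) (hfi : Integrable f (stdGaussian E))
    (hm : 0 < ∫ x, f x ∂(stdGaussian E)) :
    ∫⁻ x, ENNReal.ofReal (f x * Real.log (f x) - f x * Real.log (∫ x, f x ∂(stdGaussian E)) -
      (f x - ∫ x, f x ∂(stdGaussian E))) ∂(stdGaussian E) ≤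
      2⁻¹ * ∫⁻ x, ENNReal.ofReal (‖gradient f x‖ ^ 2 / f x) ∂(stdGaussian E) := by
  set γ := stdGaussian E
  set ε : ℕ → ℝ := fun n => 1 / ((n : ℝ) + 1) with hεdef
  have hε : ∀ n, 0 < ε n := fun n => by simp only [hεdef]; positivity
  have hε1 : ∀ n, ε n ≤ 1 := fun n => by
    simp only [hεdef]
    exact div_le_self zero_le_one (by linarith [(Nat.cast_nonneg n : (0 : ℝ) ≤ n)])
  have hε0 : Tendsto ε atTop (𝓝 0) := tendsto_one_div_add_atTop_nhds_zero_nat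
  set g : ℕ → E → ℝ := fun n => truncation (ε n) f with hg
  have hgb : ∀ n x, g n x ∈ Icc (ε n) (ε n + (ε n)⁻¹) := fun n x =>
    truncation_mem_Icc (hε n) (hf0 x)
  have hgd : ∀ n, Differentiable ℝ (g n) := fun n x =>
    (hasFDerivAt_truncation (hε n) (hf0 x) (hf x)).differentiableAt
  have hgm : ∀ n, Measurable (g n) := fun n => (hgd n).continuous.measurable
  have hgt : ∀ x, Tendsto (fun n => g n x) atTop (𝓝 (f x)) := fun x =>
    (tendsto_truncation f x).comp hε0
  have hmt : Tendsto (fun n => ∫ x, g n x ∂γ) atTop (𝓝 (∫ x, f x ∂γ)) := by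
    refine tendsto_integral_of_dominated_convergence (fun x => 1 + f x)
      (fun n => (hgm n).aestronglyMeasurable) ((integrable_const 1).add hfi)
      (fun n => ae_of_all _ fun x => ?_) (ae_of_all _ hgt)
    rw [Real.norm_of_nonneg ((hε n).le.trans (hgb n x).1)]
    exact (truncation_le (hε n) (hf0 x)).trans (by linarith [hε1 n])
  have hbound : ∀ n, ∫⁻ x, ENNReal.ofReal (g n x * Real.log (g n x) -
      g n x * Real.log (∫ x, g n x ∂γ) - (g n x - ∫ x, g n x ∂γ)) ∂γ ≤
      2⁻¹ * ∫⁻ x, ENNReal.ofReal (‖gradient f x‖ ^ 2 / f x) ∂γ := by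
    intro n
    rw [lintegral_ofReal_sub_eq_realEntropy (hε n) (hgm n) (hgb n)]
    refine (ofReal_realEntropy_stdGaussian_le (hε n) (hgd n) (hgb n)).trans ?_
    refine mul_le_mul_right (lintegral_mono fun x => ENNReal.ofReal_le_ofReal ?_) _
    exact norm_gradient_truncation_le (hε n) hf0 hf x
  have hlim : ∀ x, Tendsto (fun n => ENNReal.ofReal (g n x * Real.log (g n x) -
      g n x * Real.log (∫ x, g n x ∂γ) - (g n x - ∫ x, g n x ∂γ))) atTop
      (𝓝 (ENNReal.ofReal (f x * Real.log (f x) - f x * Real.log (∫ x, f x ∂γ) -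
      (f x - ∫ x, f x ∂γ)))) := fun x =>
    -- Continuity of `u log u` at `0` covers the zeros of `f`.
    ENNReal.tendsto_ofReal
      ((((Real.continuous_mul_log.tendsto (f x)).comp (hgt x)).sub
        ((hgt x).mul (hmt.log hm.ne'))).sub ((hgt x).sub hmt))
  calc _ = ∫⁻ x, liminf (fun n => ENNReal.ofReal (g n x * Real.log (g n x) -
      g n x * Real.log (∫ x, g n x ∂γ) - (g n x - ∫ x, g n x ∂γ))) atTop ∂γ :=
        lintegral_congr fun x => (hlim x).liminf_eq.symm
    _ ≤ liminf (fun n => ∫⁻ x, ENNReal.ofReal (g n x * Real.log (g n x) -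
      g n x * Real.log (∫ x, g n x ∂γ) - (g n x - ∫ x, g n x ∂γ)) ∂γ) atTop :=
        lintegral_liminf_le fun n => ((((hgm n).mul (Real.measurable_log.comp (hgm n))).sub
          ((hgm n).mul_const _)).sub ((hgm n).sub_const _)).ennreal_ofReal
    _ ≤ _ := (liminf_le_liminf (Eventually.of_forall hbound)).trans_eq (liminf_const _)

/-- A bound on `∫ (f log (f / m) - f + m) dμ` bounds the functional entropy of `f`. -/
theorem functionalEntropy_le_of_lintegral_le {X : Type*} [MeasurableSpace X] {μ : Measure X}
    [IsProbabilityMeasure μ] {f : X → ℝ} {K : ℝ≥0∞} (hf0 : ∀ x, 0 ≤ f x) (hf : Measurable f)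
    (hfi : Integrable f μ) (hK : 0 < ∫ x, f x ∂μ →
      ∫⁻ x, ENNReal.ofReal (f x * Real.log (f x) - f x * Real.log (∫ x, f x ∂μ) -
        (f x - ∫ x, f x ∂μ)) ∂μ ≤ K) :
    functionalEntropy μ f ≤ (K : EReal) := by
  rw [functionalEntropy]
  obtain ⟨m, hm⟩ : ∃ m, m = ∫ x, f x ∂μ := ⟨_, rfl⟩
  rw [← hm] at hK ⊢
  rcases (hm ▸ integral_nonneg hf0 : 0 ≤ m).eq_or_lt with h0 | h0
  · subst h0
    -- With mean zero, `f / 0 = 0` and `log 0 = 0` make the entropy vanish.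
    simpa using EReal.coe_ennreal_nonneg K
  rcases eq_or_ne K ⊤ with rfl | hKtop
  · simp
  replace hK := hK h0
  have hl : ∀ x, f x * Real.log (f x / m) = f x * Real.log (f x) - f x * Real.log m := by
    intro x
    rcases (hf0 x).eq_or_lt with h | h
    · simp [← h]
    · rw [Real.log_div h.ne' h0.ne', mul_sub]
  have hnn : ∀ x, 0 ≤ f x * Real.log (f x) - f x * Real.log m - (f x - m) := by
    intro x
    rcases (hf0 x).eq_or_lt with h | h
    · simp [← h, h0.le]
    · exact sub_nonneg.2 (sub_le_mul_log_sub h h0)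
  have hψm : Measurable fun x => f x * Real.log (f x) - f x * Real.log m - (f x - m) :=
    ((hf.mul (Real.measurable_log.comp hf)).sub (hf.mul_const _)).sub (hf.sub_const _)
  -- Finiteness of `K` gives integrability, so positive and negative parts can be subtracted as
  -- reals.
  have hψi : Integrable (fun x => f x * Real.log (f x) - f x * Real.log m - (f x - m)) μ :=
    (lintegral_ofReal_ne_top_iff_integrable hψm.aestronglyMeasurable (ae_of_all _ hnn)).1
      (ne_top_of_le_ne_top hKtop hK)
  have hfm : Integrable (fun x => f x - m) μ := hfi.sub (integrable_const m)
  have hgi : Integrable (fun x => f x * Real.log (f x / m)) μ := by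
    refine (hψi.add hfm).congr (ae_of_all _ fun x => ?_)
    simp only [Pi.add_apply, hl]
    ring
  have hint : ∫ x, f x * Real.log (f x / m) ∂μ =
      ∫ x, (f x * Real.log (f x) - f x * Real.log m - (f x - m)) ∂μ := by
    have h : ∫ x, (f x - m) ∂μ = 0 := by
      rw [integral_sub hfi (integrable_const m), ← hm]; simp
    rw [← add_zero (∫ x, (f x * Real.log (f x) - f x * Real.log m - (f x - m)) ∂μ), ← h,
      ← integral_add hψi hfm]
    refine integral_congr_ae (ae_of_all _ fun x => ?_)
    simp only [hl]
    ring
  have hp : ∫⁻ x, ENNReal.ofReal (f x * Real.log (f x / m)) ∂μ ≠ ⊤ := hgi.lintegral_lt_top.ne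
  have hn : ∫⁻ x, ENNReal.ofReal (-(f x * Real.log (f x / m))) ∂μ ≠ ⊤ :=
    hgi.neg.lintegral_lt_top.ne
  have hKr : ∫ x, f x * Real.log (f x / m) ∂μ ≤ K.toReal := by
    rw [hint, integral_eq_lintegral_of_nonneg_ae (ae_of_all _ hnn) hψm.aestronglyMeasurable]
    exact ENNReal.toReal_mono hKtop hK
  rw [integral_eq_lintegral_pos_part_sub_lintegral_neg_part hgi] at hKr
  rw [← EReal.coe_ennreal_toReal hp, ← EReal.coe_ennreal_toReal hn,
    ← EReal.coe_ennreal_toReal hKtop, ← EReal.coe_sub]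
  exact_mod_cast hKr

/-- The Gaussian logarithmic Sobolev inequality for the standard Gaussian measure. -/
theorem functionalEntropy_stdGaussian_le {f : E → ℝ} (hf0 : ∀ x, 0 ≤ f x)
    (hf : Differentiable ℝ f) (hfi : Integrable f (stdGaussian E)) :
    functionalEntropy (stdGaussian E) f ≤
      ((2⁻¹ * ∫⁻ x, ENNReal.ofReal (‖gradient f x‖ ^ 2 / f x) ∂(stdGaussian E) : ℝ≥0∞) : EReal) :=
  functionalEntropy_le_of_lintegral_le hf0 hf.continuous.measurable hfi
    (lintegral_ofReal_entropy_stdGaussian_le hf0 hf hfi)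

theorem functionalEntropy_map {X Y : Type*} [MeasurableSpace X] [MeasurableSpace Y]
    {μ : Measure X} {T : X → Y} (hT : Measurable T) {f : Y → ℝ} (hf : Measurable f) :
    functionalEntropy (μ.map T) f = functionalEntropy μ (fun x => f (T x)) := by
  have h : ∀ a, Measurable fun y => f y * Real.log (f y / a) := fun a =>
    hf.mul (Real.measurable_log.comp (hf.div_const a))
  rw [functionalEntropy, functionalEntropy, integral_map hT.aemeasurable hf.aestronglyMeasurable,
    lintegral_map (h _).ennreal_ofReal hT, lintegral_map (f := fun y => ENNReal.ofReal (-(f y * Real.log (f y / _))))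
      (h _).neg.ennreal_ofReal hT]

end LogSobolev

/-! ### General Gaussian measures as affine images. -/

section MultivariateGaussian

open scoped MatrixOrder

theorem measurable_gradient {E : Type*} [NormedAddCommGroup E] [InnerProductSpace ℝ E]
    [CompleteSpace E] [MeasurableSpace E] [BorelSpace E] (f : E → ℝ) : Measurable (gradient f) := by
  borelize (E →L[ℝ] ℝ)
  exact (InnerProductSpace.toDual ℝ E).symm.continuous.measurable.comp (measurable_fderiv ℝ f)

theorem measurable_fisherDensity {ι : Type*} [Fintype ι] (S : Matrix ι ι ℝ) {f : EuclideanSpace ℝ ι → ℝ}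
    (hf : Measurable f) : Measurable (fisherDensity S f) := by
  refine Measurable.div ?_ hf
  have hc : Continuous fun v : EuclideanSpace ℝ ι => (S *ᵥ v.ofLp) ⬝ᵥ v.ofLp := by fun_prop
  exact hc.measurable.comp (measurable_gradient f)

variable {ι : Type*} [Fintype ι] [DecidableEq ι]

/-- The square root is self-adjoint, so it moves across the inner product and squares to `S`. -/
theorem mulVec_sqrt_dotProduct {S : Matrix ι ι ℝ} (hS : S.PosSemidef) (v : EuclideanSpace ℝ ι) :
    (S *ᵥ v.ofLp) ⬝ᵥ v.ofLp = ‖toEuclideanCLM (𝕜 := ℝ) (CFC.sqrt S) v‖ ^ 2 := by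
  rw [← real_inner_self_eq_norm_sq, ← ContinuousLinearMap.adjoint_inner_left,
    IsSelfAdjoint.adjoint_eq, ← ContinuousLinearMap.comp_apply, ← ContinuousLinearMap.mul_def,
    ← map_mul, CFC.sqrt_mul_sqrt_self _ hS.nonneg, real_inner_comm, inner_toEuclideanCLM]
  · simp [dotProduct_comm]
  · exact (CFC.sqrt_nonneg S).isSelfAdjoint.map _

theorem hasFDerivAt_comp_const_add {E F : Type*} [NormedAddCommGroup E] [NormedSpace ℝ E]
    [NormedAddCommGroup F] [NormedSpace ℝ F] {f : F → ℝ} (hf : Differentiable ℝ f) (x : F)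
    (A : E →L[ℝ] F) (z : E) :
    HasFDerivAt (fun z => f (x + A z)) ((fderiv ℝ f (x + A z)).comp A) z :=
  (hf (x + A z)).hasFDerivAt.comp z (A.hasFDerivAt.const_add x)

theorem gradient_comp_const_add {E F : Type*} [NormedAddCommGroup E] [InnerProductSpace ℝ E]
    [CompleteSpace E] [NormedAddCommGroup F] [InnerProductSpace ℝ F] [CompleteSpace F]
    {f : F → ℝ} (hf : Differentiable ℝ f) (x : F) (A : E →L[ℝ] F) (z : E) :
    gradient (fun z => f (x + A z)) z =
      ContinuousLinearMap.adjoint A (gradient f (x + A z)) := by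
  refine ext_inner_right ℝ fun w => ?_
  rw [ContinuousLinearMap.adjoint_inner_left]
  simp [gradient, (hasFDerivAt_comp_const_add hf x A z).fderiv]

/-- The Gaussian logarithmic Sobolev inequality. -/
theorem functionalEntropy_multivariateGaussian_le (x : EuclideanSpace ℝ ι) {S : Matrix ι ι ℝ}
    (hS : S.PosSemidef) {f : EuclideanSpace ℝ ι → ℝ} (hf0 : ∀ z, 0 ≤ f z)
    (hf : Differentiable ℝ f) (hfi : Integrable f (multivariateGaussian x S)) :
    functionalEntropy (multivariateGaussian x S) f ≤
      ((2⁻¹ * fisherInfo (multivariateGaussian x S) S f : ℝ≥0∞) : EReal) := by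
  obtain ⟨A, hA⟩ : ∃ A : EuclideanSpace ℝ ι →L[ℝ] EuclideanSpace ℝ ι,
    A = toEuclideanCLM (𝕜 := ℝ) (CFC.sqrt S) := ⟨_, rfl⟩
  have hAs : IsSelfAdjoint A := hA ▸ (CFC.sqrt_nonneg S).isSelfAdjoint.map _
  have hT : Measurable fun z => x + A z := by fun_prop
  have hfm := hf.continuous.measurable
  have hmap : multivariateGaussian x S =
      (stdGaussian (EuclideanSpace ℝ ι)).map fun z => x + A z := by
    rw [multivariateGaussian, hA]
  have hinfo : fisherInfo (multivariateGaussian x S) S f =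
      ∫⁻ z, ENNReal.ofReal (‖gradient (fun z => f (x + A z)) z‖ ^ 2 / f (x + A z))
        ∂(stdGaussian (EuclideanSpace ℝ ι)) := by
    rw [fisherInfo, hmap,
      lintegral_map (measurable_fisherDensity S hfm).ennreal_ofReal hT]
    refine lintegral_congr fun z => ?_
    rw [fisherDensity, mulVec_sqrt_dotProduct hS, gradient_comp_const_add hf, hAs.adjoint_eq, hA]
  rw [hinfo, hmap, functionalEntropy_map hT hfm]
  refine functionalEntropy_stdGaussian_le (fun z => hf0 _)
    (fun z => (hasFDerivAt_comp_const_add hf x A z).differentiableAt) ?_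
  rw [hmap, integrable_map_measure hfm.aestronglyMeasurable hT.aemeasurable] at hfi
  exact hfi

end MultivariateGaussian

/-! ### Schur complements. -/

section Blocks

variable {d₁ d₂ : ℕ} {S : Matrix (Fin d₁ ⊕ Fin d₂) (Fin d₁ ⊕ Fin d₂) ℝ}

theorem posDef_toBlocks₂₂ (hS : S.PosDef) : S.toBlocks₂₂.PosDef :=
  hS.submatrix Sum.inr_injective

theorem toBlocks₂₁_eq_conjTranspose (hS : S.PosDef) : S.toBlocks₂₁ = S.toBlocks₁₂ᴴ := by
  ext i j
  exact (hS.isHermitian.apply (Sum.inr i) (Sum.inl j)).symm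

theorem condCov_eq (hS : S.PosDef) :
    condCov S = S.toBlocks₁₁ - S.toBlocks₁₂ * S.toBlocks₂₂⁻¹ * S.toBlocks₁₂ᴴ := by
  rw [condCov, toBlocks₂₁_eq_conjTranspose hS]

theorem fromBlocks_eq_self (hS : S.PosDef) :
    fromBlocks S.toBlocks₁₁ S.toBlocks₁₂ S.toBlocks₁₂ᴴ S.toBlocks₂₂ = S := by
  rw [← toBlocks₂₁_eq_conjTranspose hS, fromBlocks_toBlocks]

theorem posSemidef_condCov (hS : S.PosDef) : (condCov S).PosSemidef := by
  have hD := posDef_toBlocks₂₂ hS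
  let _ := hD.isUnit.invertible
  rw [condCov_eq hS, ← PosDef.fromBlocks₂₂ _ _ hD, fromBlocks_eq_self hS]
  exact hS.posSemidef

/-- The block decomposition of the quadratic form of `S` by the Schur complement. -/
theorem dotProduct_mulVec_eq_condCov (hS : S.PosDef) (v : Fin d₁ ⊕ Fin d₂ → ℝ) :
    v ⬝ᵥ S *ᵥ v =
      (v ∘ Sum.inr + (S.toBlocks₁₂ * S.toBlocks₂₂⁻¹)ᵀ *ᵥ (v ∘ Sum.inl)) ⬝ᵥ S.toBlocks₂₂ *ᵥ
        (v ∘ Sum.inr + (S.toBlocks₁₂ * S.toBlocks₂₂⁻¹)ᵀ *ᵥ (v ∘ Sum.inl)) +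
      (v ∘ Sum.inl) ⬝ᵥ condCov S *ᵥ (v ∘ Sum.inl) := by
  have hD := posDef_toBlocks₂₂ hS
  let _ := hD.isUnit.invertible
  have hM : (S.toBlocks₁₂ * S.toBlocks₂₂⁻¹)ᵀ = S.toBlocks₂₂⁻¹ * S.toBlocks₁₂ᴴ := by
    rw [← conjTranspose_eq_transpose_of_trivial, conjTranspose_mul, hD.isHermitian.inv.eq]
  have h := schur_complement_eq₂₂ S.toBlocks₁₁ S.toBlocks₁₂ (v ∘ Sum.inl) (v ∘ Sum.inr)
    hD.isHermitian
  rw [Sum.elim_comp_inl_inr, fromBlocks_eq_self hS, ← condCov_eq hS] at h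
  simp only [star_trivial, ← dotProduct_mulVec] at h
  rw [h, hM, add_comm (v ∘ Sum.inr)]

/-- The difference of the two sides is a value of the quadratic form of `Σ₂₂`, hence nonnegative. -/
theorem condCov_dotProduct_le (hS : S.PosDef) (v : Fin d₁ ⊕ Fin d₂ → ℝ) :
    (condCov S *ᵥ (v ∘ Sum.inl)) ⬝ᵥ (v ∘ Sum.inl) ≤ (S *ᵥ v) ⬝ᵥ v := by
  rw [dotProduct_comm, dotProduct_comm (S *ᵥ v), dotProduct_mulVec_eq_condCov hS v]
  refine le_add_of_nonneg_left ?_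
  have h := (posDef_toBlocks₂₂ hS).posSemidef.dotProduct_mulVec_nonneg
    (v ∘ Sum.inr + (S.toBlocks₁₂ * S.toBlocks₂₂⁻¹)ᵀ *ᵥ (v ∘ Sum.inl))
  rwa [star_trivial] at h

end Blocks

/-! ### Slices in the first block and their gradients. -/

section JoinVec

variable {d₁ d₂ : ℕ}

theorem inner_joinVec (z₁ : EuclideanSpace ℝ (Fin d₁)) (z₂ : EuclideanSpace ℝ (Fin d₂))
    (t : EuclideanSpace ℝ (Fin d₁ ⊕ Fin d₂)) :
    inner ℝ (joinVec z₁ z₂) t =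
      inner ℝ z₁ (WithLp.toLp 2 (t.ofLp ∘ Sum.inl)) +
        inner ℝ z₂ (WithLp.toLp 2 (t.ofLp ∘ Sum.inr)) := by
  simp [PiLp.inner_apply, joinVec]

/-- The embedding of the first block. -/
noncomputable def joinLeft (d₁ d₂ : ℕ) :
    EuclideanSpace ℝ (Fin d₁) →L[ℝ] EuclideanSpace ℝ (Fin d₁ ⊕ Fin d₂) :=
  LinearMap.toContinuousLinearMap
    { toFun := fun z => joinVec z 0
      map_add' := fun a b => by ext (i | i) <;> simp [joinVec]
      map_smul' := fun a b => by ext (i | i) <;> simp [joinVec] }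

theorem joinVec_eq_add (z₁ : EuclideanSpace ℝ (Fin d₁)) (z₂ : EuclideanSpace ℝ (Fin d₂)) :
    joinVec z₁ z₂ = joinVec 0 z₂ + joinLeft d₁ d₂ z₁ := by
  ext (i | i) <;> simp [joinVec, joinLeft]

theorem adjoint_joinLeft (v : EuclideanSpace ℝ (Fin d₁ ⊕ Fin d₂)) :
    ContinuousLinearMap.adjoint (joinLeft d₁ d₂) v = WithLp.toLp 2 (v.ofLp ∘ Sum.inl) := by
  refine ext_inner_left ℝ fun w => ?_
  rw [ContinuousLinearMap.adjoint_inner_right]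
  exact (inner_joinVec w 0 v).trans (by simp)

theorem measurable_joinVec {X : Type*} [MeasurableSpace X] {f : X → EuclideanSpace ℝ (Fin d₁)}
    {g : X → EuclideanSpace ℝ (Fin d₂)} (hf : Measurable f) (hg : Measurable g) :
    Measurable fun x => joinVec (f x) (g x) := by
  refine (WithLp.measurable_toLp 2 _).comp (measurable_pi_iff.2 ?_)
  rintro (i | i)
  · exact (by fun_prop : Measurable fun z : EuclideanSpace ℝ (Fin d₁) => z i).comp hf
  · exact (by fun_prop : Measurable fun z : EuclideanSpace ℝ (Fin d₂) => z i).comp hg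

theorem comp_joinVec_eq (f : EuclideanSpace ℝ (Fin d₁ ⊕ Fin d₂) → ℝ)
    (z₂ : EuclideanSpace ℝ (Fin d₂)) :
    (fun z₁ : EuclideanSpace ℝ (Fin d₁) => f (joinVec z₁ z₂)) =
      fun z₁ => f (joinVec 0 z₂ + joinLeft d₁ d₂ z₁) :=
  funext fun z₁ => by rw [← joinVec_eq_add]

theorem differentiable_comp_joinVec {f : EuclideanSpace ℝ (Fin d₁ ⊕ Fin d₂) → ℝ}
    (hf : Differentiable ℝ f) (z₂ : EuclideanSpace ℝ (Fin d₂)) :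
    Differentiable ℝ fun z₁ : EuclideanSpace ℝ (Fin d₁) => f (joinVec z₁ z₂) := by
  rw [comp_joinVec_eq]
  exact fun z => (hasFDerivAt_comp_const_add hf _ _ z).differentiableAt

theorem gradient_comp_joinVec {f : EuclideanSpace ℝ (Fin d₁ ⊕ Fin d₂) → ℝ}
    (hf : Differentiable ℝ f) (z₁ : EuclideanSpace ℝ (Fin d₁)) (z₂ : EuclideanSpace ℝ (Fin d₂)) :
    gradient (fun z₁ : EuclideanSpace ℝ (Fin d₁) => f (joinVec z₁ z₂)) z₁ =
      WithLp.toLp 2 ((gradient f (joinVec z₁ z₂)).ofLp ∘ Sum.inl) := by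
  rw [comp_joinVec_eq, gradient_comp_const_add hf, ← joinVec_eq_add, adjoint_joinLeft]

theorem fisherDensity_comp_joinVec_le {S : Matrix (Fin d₁ ⊕ Fin d₂) (Fin d₁ ⊕ Fin d₂) ℝ}
    (hS : S.PosDef) {f : EuclideanSpace ℝ (Fin d₁ ⊕ Fin d₂) → ℝ} (hf0 : ∀ z, 0 ≤ f z)
    (hf : Differentiable ℝ f) (z₁ : EuclideanSpace ℝ (Fin d₁)) (z₂ : EuclideanSpace ℝ (Fin d₂)) :
    fisherDensity (condCov S) (fun z₁ => f (joinVec z₁ z₂)) z₁ ≤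
      fisherDensity S f (joinVec z₁ z₂) := by
  rw [fisherDensity, fisherDensity, gradient_comp_joinVec hf]
  exact div_le_div_of_nonneg_right (condCov_dotProduct_le hS _) (hf0 _)

end JoinVec

/-! ### Conditional and marginal laws. -/

section Disintegration

variable {d₁ d₂ : ℕ} (x₁ : EuclideanSpace ℝ (Fin d₁)) (x₂ : EuclideanSpace ℝ (Fin d₂))
  {S : Matrix (Fin d₁ ⊕ Fin d₂) (Fin d₁ ⊕ Fin d₂) ℝ}

/-- The regression term `M (z₂ - x₂)`. -/
noncomputable def regression (M : Matrix (Fin d₁) (Fin d₂) ℝ) (z₂ : EuclideanSpace ℝ (Fin d₂)) :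
    EuclideanSpace ℝ (Fin d₁) :=
  WithLp.toLp 2 (M *ᵥ (z₂ - x₂).ofLp)

theorem measurable_regression (M : Matrix (Fin d₁) (Fin d₂) ℝ) : Measurable (regression x₂ M) := by
  unfold regression
  have : Continuous fun z₂ : EuclideanSpace ℝ (Fin d₂) => WithLp.toLp 2 (M *ᵥ (z₂ - x₂).ofLp) := by
    fun_prop
  exact this.measurable

theorem measurable_joinVec_add_regression (M : Matrix (Fin d₁) (Fin d₂) ℝ) :
    Measurable fun p : EuclideanSpace ℝ (Fin d₁) × EuclideanSpace ℝ (Fin d₂) =>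
      joinVec (p.1 + regression x₂ M p.2) p.2 :=
  measurable_joinVec (measurable_fst.add ((measurable_regression x₂ M).comp measurable_snd))
    measurable_snd

theorem inner_regression (M : Matrix (Fin d₁) (Fin d₂) ℝ) (z₂ : EuclideanSpace ℝ (Fin d₂))
    (t : Fin d₁ → ℝ) :
    inner ℝ (regression x₂ M z₂) (WithLp.toLp 2 t) =
      inner ℝ z₂ (WithLp.toLp 2 (Mᵀ *ᵥ t)) - inner ℝ x₂ (WithLp.toLp 2 (Mᵀ *ᵥ t)) := by
  rw [← inner_sub_left]
  simp only [regression, EuclideanSpace.inner_eq_star_dotProduct, star_trivial]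
  rw [mulVec_transpose, ← dotProduct_mulVec]

/-- Only the mean depends on `z₂`: each conditional law is a translate of one fixed Gaussian, so the
disintegration becomes Fubini. -/
theorem condLaw_eq_map (z₂ : EuclideanSpace ℝ (Fin d₂)) :
    condLaw x₁ x₂ S z₂ = (multivariateGaussian x₁ (condCov S)).map
      fun w => w + regression x₂ (S.toBlocks₁₂ * S.toBlocks₂₂⁻¹) z₂ := by
  rw [condLaw, multivariateGaussian, multivariateGaussian,
    Measure.map_map (by fun_prop) (by fun_prop)]
  congr 1
  ext1 w
  simp only [condMean, regression, Function.comp_apply]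
  abel

/-- The joint law is the image of independent copies of the residual and of the second block. -/
theorem jointLaw_eq_map (hS : S.PosDef) :
    jointLaw x₁ x₂ S = ((multivariateGaussian x₁ (condCov S)).prod (marginalLaw x₂ S)).map
      fun p => joinVec (p.1 + regression x₂ (S.toBlocks₁₂ * S.toBlocks₂₂⁻¹) p.2) p.2 := by
  set M := S.toBlocks₁₂ * S.toBlocks₂₂⁻¹ with hM
  have : IsProbabilityMeasure (marginalLaw x₂ S) := by unfold marginalLaw; infer_instance
  have : IsProbabilityMeasure (jointLaw x₁ x₂ S) := by unfold jointLaw; infer_instance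
  have hT := measurable_joinVec_add_regression x₂ M
  have := Measure.isProbabilityMeasure_map (μ := (multivariateGaussian x₁ (condCov S)).prod
    (marginalLaw x₂ S)) hT.aemeasurable
  refine Measure.ext_of_charFun (funext fun t => ?_)
  set t₁ : Fin d₁ → ℝ := t.ofLp ∘ Sum.inl with ht₁
  set t₂ : Fin d₂ → ℝ := t.ofLp ∘ Sum.inr with ht₂
  have hinner : ∀ p : EuclideanSpace ℝ (Fin d₁) × EuclideanSpace ℝ (Fin d₂),
      inner ℝ (joinVec (p.1 + regression x₂ M p.2) p.2) t =
        inner ℝ p.1 (WithLp.toLp 2 t₁) + inner ℝ p.2 (WithLp.toLp 2 (t₂ + Mᵀ *ᵥ t₁)) -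
          inner ℝ x₂ (WithLp.toLp 2 (Mᵀ *ᵥ t₁)) := by
    intro p
    rw [inner_joinVec, inner_add_left, inner_regression, WithLp.toLp_add, inner_add_right]
    ring
  have hexp : ∀ p : EuclideanSpace ℝ (Fin d₁) × EuclideanSpace ℝ (Fin d₂),
      Complex.exp ((inner ℝ (joinVec (p.1 + regression x₂ M p.2) p.2) t : ℝ) * Complex.I) =
        Complex.exp ((inner ℝ p.1 (WithLp.toLp 2 t₁) : ℝ) * Complex.I) *
          Complex.exp ((inner ℝ p.2 (WithLp.toLp 2 (t₂ + Mᵀ *ᵥ t₁)) : ℝ) * Complex.I) *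
          Complex.exp (-(inner ℝ x₂ (WithLp.toLp 2 (Mᵀ *ᵥ t₁)) : ℝ) * Complex.I) := by
    intro p
    rw [hinner, ← Complex.exp_add, ← Complex.exp_add]
    congr 1
    push_cast
    ring
  -- Independence factors the characteristic function; the regression term shifts the frequency of
  -- the second block by `Mᵀ t₁`, just as in the Schur decomposition.
  have hr : charFun (((multivariateGaussian x₁ (condCov S)).prod (marginalLaw x₂ S)).map
      fun p => joinVec (p.1 + regression x₂ M p.2) p.2) t =
      charFun (multivariateGaussian x₁ (condCov S)) (WithLp.toLp 2 t₁) *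
        charFun (marginalLaw x₂ S) (WithLp.toLp 2 (t₂ + Mᵀ *ᵥ t₁)) *
        Complex.exp (-(inner ℝ x₂ (WithLp.toLp 2 (Mᵀ *ᵥ t₁)) : ℝ) * Complex.I) := by
    have hce : Measurable fun z => Complex.exp ((inner ℝ z t : ℝ) * Complex.I) := by fun_prop
    rw [charFun_apply, integral_map hT.aemeasurable hce.aestronglyMeasurable]
    simp only [hexp]
    rw [integral_mul_const, charFun_apply, charFun_apply]
    congr 1
    exact integral_prod_mul
      (fun w : EuclideanSpace ℝ (Fin d₁) =>
        Complex.exp ((inner ℝ w (WithLp.toLp 2 t₁) : ℝ) * Complex.I))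
      (fun z : EuclideanSpace ℝ (Fin d₂) =>
        Complex.exp ((inner ℝ z (WithLp.toLp 2 (t₂ + Mᵀ *ᵥ t₁)) : ℝ) * Complex.I))
  rw [hr, jointLaw, marginalLaw, charFun_multivariateGaussian hS.posSemidef,
    charFun_multivariateGaussian (posSemidef_condCov hS),
    charFun_multivariateGaussian (posDef_toBlocks₂₂ hS).posSemidef, ← Complex.exp_add,
    ← Complex.exp_add, dotProduct_mulVec_eq_condCov hS, ← hM, ← ht₁, ← ht₂]
  congr 1
  rw [real_inner_comm, inner_joinVec, ← ht₁, ← ht₂, WithLp.toLp_add, inner_add_left,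
    real_inner_comm x₁, real_inner_comm x₂, real_inner_comm x₂]
  simp only [WithLp.ofLp_add]
  push_cast
  ring

theorem lintegral_jointLaw (hS : S.PosDef)
    {F : EuclideanSpace ℝ (Fin d₁ ⊕ Fin d₂) → ℝ≥0∞} (hF : Measurable F) :
    ∫⁻ z, F z ∂(jointLaw x₁ x₂ S) =
      ∫⁻ z₂, ∫⁻ z₁, F (joinVec z₁ z₂) ∂(condLaw x₁ x₂ S z₂) ∂(marginalLaw x₂ S) := by
  have : IsProbabilityMeasure (marginalLaw x₂ S) := by unfold marginalLaw; infer_instance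
  have hT := measurable_joinVec_add_regression x₂ (S.toBlocks₁₂ * S.toBlocks₂₂⁻¹)
  rw [jointLaw_eq_map x₁ x₂ hS, lintegral_map hF hT]
  refine (lintegral_prod_symm _ (hF.comp hT).aemeasurable).trans (lintegral_congr fun z₂ => ?_)
  rw [condLaw_eq_map]
  have hFz : Measurable fun z₁ : EuclideanSpace ℝ (Fin d₁) => F (joinVec z₁ z₂) :=
    hF.comp (measurable_joinVec measurable_id measurable_const)
  have hadd : Measurable fun w : EuclideanSpace ℝ (Fin d₁) =>
      w + regression x₂ (S.toBlocks₁₂ * S.toBlocks₂₂⁻¹) z₂ := measurable_id.add_const _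
  exact (lintegral_map hFz hadd).symm

/-- `condLaw` is the conditional law of the first block given the second one. -/
theorem jointLaw_apply (hS : S.PosDef) {A : Set (EuclideanSpace ℝ (Fin d₁ ⊕ Fin d₂))}
    (hA : MeasurableSet A) :
    jointLaw x₁ x₂ S A =
      ∫⁻ z₂, condLaw x₁ x₂ S z₂ {z₁ | joinVec z₁ z₂ ∈ A} ∂(marginalLaw x₂ S) := by
  rw [← lintegral_indicator_one hA, lintegral_jointLaw x₁ x₂ hS (measurable_one.indicator hA)]
  exact lintegral_congr fun z₂ =>
    lintegral_indicator_one (measurable_joinVec measurable_id measurable_const hA)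

theorem functionalEntropy_jointLaw_le (hS : S.PosDef)
    {f : EuclideanSpace ℝ (Fin d₁ ⊕ Fin d₂) → ℝ} (hf0 : ∀ z, 0 ≤ f z) (hf : Differentiable ℝ f)
    (hfi : Integrable f (jointLaw x₁ x₂ S)) :
    functionalEntropy (jointLaw x₁ x₂ S) f ≤
      ((2⁻¹ * ∫⁻ z₂, condFisherInfo x₁ x₂ S f z₂ ∂(marginalLaw x₂ S) : ℝ≥0∞) : EReal) := by
  have h : fisherInfo (jointLaw x₁ x₂ S) S f =
      ∫⁻ z₂, condFisherInfo x₁ x₂ S f z₂ ∂(marginalLaw x₂ S) :=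
    lintegral_jointLaw x₁ x₂ hS (measurable_fisherDensity S hf.continuous.measurable).ennreal_ofReal
  rw [← h]
  exact functionalEntropy_multivariateGaussian_le _ hS.posSemidef hf0 hf hfi

theorem fisherInfo_condLaw_le_condFisherInfo (hS : S.PosDef)
    {f : EuclideanSpace ℝ (Fin d₁ ⊕ Fin d₂) → ℝ} (hf0 : ∀ z, 0 ≤ f z) (hf : Differentiable ℝ f)
    (z₂ : EuclideanSpace ℝ (Fin d₂)) :
    fisherInfo (condLaw x₁ x₂ S z₂) (condCov S) (fun z₁ => f (joinVec z₁ z₂)) ≤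
      condFisherInfo x₁ x₂ S f z₂ :=
  lintegral_mono fun z₁ =>
    ENNReal.ofReal_le_ofReal (fisherDensity_comp_joinVec_le hS hf0 hf z₁ z₂)

theorem functionalEntropy_condLaw_le (hS : S.PosDef)
    {f : EuclideanSpace ℝ (Fin d₁ ⊕ Fin d₂) → ℝ} (hf0 : ∀ z, 0 ≤ f z) (hf : Differentiable ℝ f)
    (z₂ : EuclideanSpace ℝ (Fin d₂))
    (hfi : Integrable (fun z₁ => f (joinVec z₁ z₂)) (condLaw x₁ x₂ S z₂)) :
    functionalEntropy (condLaw x₁ x₂ S z₂) (fun z₁ => f (joinVec z₁ z₂)) ≤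
      ((2⁻¹ * fisherInfo (condLaw x₁ x₂ S z₂) (condCov S)
        (fun z₁ => f (joinVec z₁ z₂)) : ℝ≥0∞) : EReal) :=
  functionalEntropy_multivariateGaussian_le _ (posSemidef_condCov hS) (fun _ => hf0 _)
    (differentiable_comp_joinVec hf z₂) hfi

end Disintegration

end GaussianLogSobolev


/-! ### The joint and conditional inequalities. -/

theorem corollary2 (d₁ d₂ : ℕ)
    (x₁ : EuclideanSpace ℝ (Fin d₁)) (x₂ : EuclideanSpace ℝ (Fin d₂))
    (S : Matrix (Fin d₁ ⊕ Fin d₂) (Fin d₁ ⊕ Fin d₂) ℝ) (hS : S.PosDef) :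
    -- `μ₁` is the conditional law of `z₁` given `z₂` under `μ`, and `μ₂` the marginal of `z₂`
    (∀ A : Set (EuclideanSpace ℝ (Fin d₁ ⊕ Fin d₂)), MeasurableSet A →
      GaussianLogSobolev.jointLaw x₁ x₂ S A =
        ∫⁻ z₂, GaussianLogSobolev.condLaw x₁ x₂ S z₂
          {z₁ | GaussianLogSobolev.joinVec z₁ z₂ ∈ A}
          ∂(GaussianLogSobolev.marginalLaw x₂ S)) ∧
    ∀ f : EuclideanSpace ℝ (Fin d₁ ⊕ Fin d₂) → ℝ, (∀ z, 0 ≤ f z) → Differentiable ℝ f →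
      -- the entropy bound under conditioning
      (Integrable f (GaussianLogSobolev.jointLaw x₁ x₂ S) →
        GaussianLogSobolev.functionalEntropy (GaussianLogSobolev.jointLaw x₁ x₂ S) f ≤
          ((2⁻¹ * ∫⁻ z₂, GaussianLogSobolev.condFisherInfo x₁ x₂ S f z₂
            ∂(GaussianLogSobolev.marginalLaw x₂ S) : ℝ≥0∞) : EReal)) ∧
      -- the conditional log-Sobolev inequality, for every fixed value of the second block
      (∀ z₂ : EuclideanSpace ℝ (Fin d₂),
        Integrable (fun z₁ => f (GaussianLogSobolev.joinVec z₁ z₂))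
          (GaussianLogSobolev.condLaw x₁ x₂ S z₂) →
        GaussianLogSobolev.functionalEntropy (GaussianLogSobolev.condLaw x₁ x₂ S z₂)
            (fun z₁ => f (GaussianLogSobolev.joinVec z₁ z₂)) ≤
          ((2⁻¹ * GaussianLogSobolev.fisherInfo (GaussianLogSobolev.condLaw x₁ x₂ S z₂)
            (GaussianLogSobolev.condCov S)
            (fun z₁ => f (GaussianLogSobolev.joinVec z₁ z₂)) : ℝ≥0∞) : EReal) ∧
        GaussianLogSobolev.functionalEntropy (GaussianLogSobolev.condLaw x₁ x₂ S z₂)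
            (fun z₁ => f (GaussianLogSobolev.joinVec z₁ z₂)) ≤
          ((2⁻¹ * GaussianLogSobolev.condFisherInfo x₁ x₂ S f z₂ : ℝ≥0∞) : EReal)) := by
  refine ⟨fun A hA => GaussianLogSobolev.jointLaw_apply x₁ x₂ hS hA, fun f hf0 hf =>
    ⟨GaussianLogSobolev.functionalEntropy_jointLaw_le x₁ x₂ hS hf0 hf, fun z₂ hfi => ?_⟩⟩
  have h := GaussianLogSobolev.functionalEntropy_condLaw_le x₁ x₂ hS hf0 hf z₂ hfi
  refine ⟨h, h.trans (EReal.coe_ennreal_le_coe_ennreal_iff.2 (mul_le_mul_right ?_ _))⟩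
  exact GaussianLogSobolev.fisherInfo_condLaw_le_condFisherInfo x₁ x₂ hS hf0 hf z₂
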